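/- Let $\Omega$ be the set of all $\omega:\mathbb N\to\mathbb Z$ with $|\omega(n+1)-\omega(n)|=1$ for all $n\ge0$ (where $\mathbb N=\{0,1,2,\dots\}$), $X=(X_n)_{n\ge0}$ the coordinate process, $\mathcal F_n=\sigma(X_0,\dots,X_n)$, $\mathcal F_\infty=\bigvee_n\mathcal F_n$, and let $P$ (with expectation $E$) be the probability on $(\Omega,\mathcal F_\infty)$ under which $X$ is the simple symmetric random walk started at $0$. Put $$S_n=\max_{k\le n}X_k,\quad S_\infty=\sup_nS_n,\quad g_p=\max\{k\le p: X_k=0\},\quad g=\sup\{k\ge0:X_k=0\},$$ $$\gamma_n=\#\{k\le n:X_k=0\},\quad \tau_a=\inf\{n\ge0:\gamma_n=a\},\quad x^+=\max(x,0).$$ Let $\varphi:\mathbb N\to[0,\infty)$ satisfy $\sum_{k\ge0}\varphi(k)=1$ and $\sum_{k\ge0}k\varphi(k)<\infty$, and put $\bar\varphi(x)=\sum_{k\ge x}\varphi(k)$. The 3-Bessel* walk is the Markov chain on $\{1,2,\dots\}$ with transition probabilities $\pi^*(x,x+1)=\frac{x+1}{2x}$ and $\pi^*(x,x-1)=\frac{x-1}{2x}$.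 **Theorem (penalisation by $\varphi(S_{g_p})$).** 1. (a) For all $n\ge0$ and $\Lambda_n\in\mathcal F_n$, $$\lim_{p\to\infty}\frac{E[\mathbf 1_{\Lambda_n}\varphi(S_{g_p})]}{E[\varphi(S_{g_p})]}=E[\mathbf 1_{\Lambda_n}M_n],\qquad M_n=\tfrac12\varphi(S_{g_n})|X_n|+\varphi(S_n)(S_n-X_n^+)+\bar\varphi(S_n).$$ (b) Under $P$, $(M_n)_{n\ge0}$ is a nonnegative $(\mathcal F_n)$-martingale which is not uniformly integrable. 2. There is a unique probability $Q$ on $(\Omega,\mathcal F_\infty)$ such that $Q(\Lambda_n)=E[\mathbf 1_{\Lambda_n}M_n]$ for all $n\ge0$ and $\Lambda_n\in\mathcal F_n$, and under $Q$: (a) $Q(g<\infty)=1$. (b) $Q(S_\infty=\infty)=\frac12$, and $Q(S_\infty=k\mid S_\infty<\infty)=\varphi(k)$ for every $k\ge0$. (c) For all $a\ge1$, $Q(\gamma_g=a,\,S_g=0)=\left(\tfrac12\right)^a\varphi(0)$, and for all $a\ge1$ and $k\ge1$, $$Q(\gamma_g=a,\,S_g=k)=\frac12\left\{\Bigl(1-\frac1{2(k+1)}\Bigr)^{a-1}-\Bigl(1-\frac1{2k}\Bigr)^{a-1}\right\}\varphi(k).$$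 In particular $Q(S_g=k)=\varphi(k)$ for every $k\ge0$. 3. Under $Q$: (a) The processes $(X_n,\,n\le g)$ and $(X_{g+1+n},\,n\ge0)$ are independent. (b) $Q(X_{g+1}=1)=Q(X_{g+1}=-1)=\frac12$; conditionally on $X_{g+1}=1$ (respectively $X_{g+1}=-1$), $(X_{g+1+n},\,n\ge0)$ (respectively $(-X_{g+1+n},\,n\ge0)$) is a 3-Bessel* walk started at $1$. (c) For all $a,b$ with $Q(\gamma_g=a,\,S_g=b)>0$, the law of $(X_n,\,n\le g)$ under $Q$ conditionally on $\{\gamma_g=a,\,S_g=b\}$ is the law of $(X_n,\,n\le\tau_a)$ under $P$ conditionally on $\{S_{\tau_a}=b\}$. -/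

import Mathlib

open MeasureTheory ProbabilityTheory Filter Topology
open scoped ENNReal

noncomputable section

namespace Penalisation

/-- The canonical space: all functions from `ℕ` to `ℤ` whose increments are `±1`.
It carries the σ-field generated by the coordinates. -/
def Traj : Type := {ω : ℕ → ℤ // ∀ n, |ω (n + 1) - ω n| = 1}

instance : MeasurableSpace Traj :=
  inferInstanceAs (MeasurableSpace {ω : ℕ → ℤ // ∀ n, |ω (n + 1) - ω n| = 1})

/-- The coordinate process. -/
def X (n : ℕ) (ω : Traj) : ℤ := ω.1 n

theorem measurable_X (n : ℕ) : Measurable (X n) :=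
  (measurable_pi_apply n).comp measurable_subtype_coe

/-- The canonical filtration `ℱ n = σ(X 0, …, X n)`. -/
def ℱ : Filtration ℕ (inferInstance : MeasurableSpace Traj) :=
  Filtration.natural X fun n => (measurable_X n).stronglyMeasurable

/-- The step `+1` or `-1` coded by a coin toss. -/
def step (b : Bool) : ℤ := if b then 1 else -1

/-- The path started at `0` with a given sequence of steps. -/
def walk (b : ℕ → Bool) : Traj :=
  ⟨fun n => ∑ i ∈ Finset.range n, step (b i), fun n => by
    simp only [Finset.sum_range_succ, add_sub_cancel_left]
    cases b n <;> simp [step]⟩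

theorem measurable_walk : Measurable walk := by
  refine Measurable.subtype_mk (measurable_pi_lambda _ fun n => ?_)
  exact Finset.measurable_sum _ fun i _ =>
    (measurable_of_countable step).comp (measurable_pi_apply i)

/-- The law `P` of the standard (simple symmetric) random walk started at `0`: the steps are
independent fair signs. -/
def P : Measure Traj :=
  (Measure.infinitePi fun _ : ℕ => (PMF.uniformOfFintype Bool).toMeasure).map walk

instance : IsProbabilityMeasure P :=
  Measure.isProbabilityMeasure_map measurable_walk.aemeasurable

/-- The one-sided maximum `S n = max {X k : k ≤ n}`. -/
def S (n : ℕ) (ω : Traj) : ℤ :=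
  (Finset.range (n + 1)).sup' Finset.nonempty_range_add_one fun k => X k ω

/-- The overall maximum `S_∞`, with values in `ℕ ∪ {∞}` (only used for paths started at `0`, for
which every `S n` is nonnegative). -/
def Sinf (ω : Traj) : ℕ∞ := ⨆ n, ((S n ω).toNat : ℕ∞)

/-- The last zero before `p`: the largest `k ≤ p` with `X k = 0`
(only used for paths started at `0`, so that there is such a `k`). -/
def lastZeroBefore (p : ℕ) (ω : Traj) : ℕ := Nat.findGreatest (fun k => X k ω = 0) p

/-- The last zero `g = sup {k : X k = 0}`, with values in `ℕ ∪ {∞}`. -/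
def lastZero (ω : Traj) : ℕ∞ := ⨆ (k : ℕ) (_ : X k ω = 0), (k : ℕ∞)

/-- The last zero as a natural number, on the event that it is finite. -/
def g (ω : Traj) : ℕ := (lastZero ω).toNat

/-- The number `γ n` of zeros in `{0, …, n}`. -/
def γ (n : ℕ) (ω : Traj) : ℕ := ((Finset.range (n + 1)).filter fun k => X k ω = 0).card

/-- The time `τ a = inf {n : γ n = a}` of the `a`-th zero, with values in `ℕ ∪ {∞}`. -/
def hitCount (a : ℕ) (ω : Traj) : ℕ∞ := ⨅ (n : ℕ) (_ : γ n ω = a), (n : ℕ∞)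

/-- The time `τ a` as a natural number, on the event that it is finite
(which has full `P`-probability for `a ≥ 1`). -/
def τ (a : ℕ) (ω : Traj) : ℕ := (hitCount a ω).toNat

/-- The value of a function on `ℕ` at the maximum `S n` (which is nonnegative for paths started
at `0`). -/
def atMax (f : ℕ → ℝ) (n : ℕ) (ω : Traj) : ℝ := f (S n ω).toNat

/-- The tail sum `x ↦ ∑_{k ≥ x} φ k`. -/
def tail (φ : ℕ → ℝ) (x : ℕ) : ℝ := ∑' k, φ (x + k)

/-- `M n = ½ φ(S_{g_n}) |X n| + φ(S n) (S n - (X n)⁺) + φ̄(S n)`, with `φ̄` the tail sum. -/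
def M (φ : ℕ → ℝ) (n : ℕ) (ω : Traj) : ℝ :=
  1 / 2 * atMax φ (lastZeroBefore n ω) ω * |(X n ω : ℝ)|
    + atMax φ n ω * ((S n ω : ℝ) - max (X n ω : ℝ) 0)
    + atMax (tail φ) n ω

/-- `Q` is the probability with `Q Λ = E[1_Λ M n]` for all `n` and all `Λ ∈ ℱ n`. -/
structure IsPenalised (φ : ℕ → ℝ) (Q : Measure Traj) : Prop where
  isProbabilityMeasure : IsProbabilityMeasure Q
  apply_eq : ∀ (n : ℕ) (Λ : Set Traj), MeasurableSet[ℱ n] Λ →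
    Q Λ = ENNReal.ofReal (∫ ω in Λ, M φ n ω ∂P)

/-- The path up to the random time `T`, that is, its lifetime `T` and `(X_{n ∧ T}, n ≥ 0)`. -/
def pathUpTo (T : Traj → ℕ) (ω : Traj) : ℕ × (ℕ → ℤ) := (T ω, fun n => X (min n (T ω)) ω)

/-- The path strictly after the last zero: `(X_{g+1+n}, n ≥ 0)`. -/
def postPath (ω : Traj) : ℕ → ℤ := fun n => X (g ω + 1 + n) ω

/-- Under `μ`, the process `Y` is a Markov chain started at `x₀` with transition
probabilities `π`. -/
def IsMarkovChainFrom {Ω : Type*} [MeasurableSpace Ω] (μ : Measure Ω) (Y : Ω → ℕ → ℤ)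
    (π : ℤ → ℤ → ℝ) (x₀ : ℤ) : Prop :=
  Measurable Y ∧ ∀ (n : ℕ) (x : ℕ → ℤ),
    μ {ω | ∀ i ≤ n, Y ω i = x i} =
      if x 0 = x₀ then ENNReal.ofReal (∏ i ∈ Finset.range n, π (x i) (x (i + 1))) else 0

/-- The transition probabilities of the 3-Bessel* walk on `{1, 2, …}`. -/
def besselStar (x y : ℤ) : ℝ :=
  if 1 ≤ x ∧ y = x + 1 then ((x : ℝ) + 1) / (2 * x)
  else if 1 ≤ x ∧ y = x - 1 then ((x : ℝ) - 1) / (2 * x)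
  else 0

/-- The joint density of `(γ_g, S_g)` at `(a, k)`, for `a ≥ 1`. -/
def jointDensity (φ : ℕ → ℝ) (a k : ℕ) : ℝ :=
  if k = 0 then (1 / 2) ^ a * φ 0
  else 1 / 2 * ((1 - 1 / (2 * ((k : ℝ) + 1))) ^ (a - 1) - (1 - 1 / (2 * (k : ℝ))) ^ (a - 1)) * φ k

end Penalisation

end

open Penalisation

namespace Penalisation

/-! ### Functions of the path up to a fixed time -/

/-- `F` depends only on the path up to time `n`. -/
def Det {β : Type*} (n : ℕ) (F : Traj → β) : Prop :=
  ∀ ω ω', (∀ i ≤ n, X i ω = X i ω') → F ω = F ω'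

theorem filtration_eq_comap (n : ℕ) :
    (ℱ n : MeasurableSpace Traj) = .comap (fun ω (j : Set.Iic n) => X j ω) inferInstance :=
  Filtration.natural_eq_comap _ _ n

theorem Det.mono {β : Type*} {n m : ℕ} {F : Traj → β} (h : Det n F) (hnm : n ≤ m) : Det m F :=
  fun ω ω' hω => h ω ω' fun i hi => hω i (hi.trans hnm)

theorem det_of_measurableSet {n : ℕ} {Λ : Set Traj} (h : MeasurableSet[ℱ n] Λ) :
    Det n (fun ω => ω ∈ Λ) := by
  rw [filtration_eq_comap] at h
  obtain ⟨T, -, rfl⟩ := h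
  intro ω ω' hω
  have : (fun j : Set.Iic n => X j ω) = fun j : Set.Iic n => X j ω' :=
    funext fun j => hω j j.2
  simp only [Set.mem_preimage, this]

theorem Det.measurable {β : Type*} [MeasurableSpace β] {n : ℕ} {F : Traj → β} (h : Det n F) :
    Measurable[ℱ n] F := by
  intro T _
  rw [filtration_eq_comap]
  refine ⟨(fun ω (j : Set.Iic n) => X j ω) '' (F ⁻¹' T), (Set.to_countable _).measurableSet, ?_⟩
  ext ω
  constructor
  · rintro ⟨ω', hω', h'⟩
    have : F ω' = F ω := h _ _ fun i hi => congrFun h' ⟨i, hi⟩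
    simpa [← this] using hω'
  · intro hω
    exact ⟨ω, hω, rfl⟩

theorem Det.measurableSet {n : ℕ} {p : Traj → Prop} (h : Det n p) :
    MeasurableSet[ℱ n] {ω | p ω} := by
  have := h.measurable (measurableSet_singleton True)
  convert this using 1
  ext ω
  simp

theorem measurableSet_of_filtration {n : ℕ} {Λ : Set Traj} (h : MeasurableSet[ℱ n] Λ) :
    MeasurableSet Λ := ℱ.le n _ h

theorem det_X {i n : ℕ} (h : i ≤ n) : Det n (X i) := fun _ _ hω => hω i h

theorem Det.comp {β δ : Type*} {n : ℕ} {F : Traj → β} (h : Det n F) (f : β → δ) :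
    Det n (fun ω => f (F ω)) := fun ω ω' hω => congrArg f (h ω ω' hω)

theorem Det.comp₂ {β δ ε : Type*} {n : ℕ} {F : Traj → β} {G : Traj → δ} (h : Det n F)
    (h' : Det n G) (f : β → δ → ε) : Det n (fun ω => f (F ω) (G ω)) :=
  fun ω ω' hω => congrArg₂ f (h ω ω' hω) (h' ω ω' hω)

theorem Det.forall {ι : Type*} {n : ℕ} {p : ι → Traj → Prop} (h : ∀ i, Det n (p i)) :
    Det n (fun ω => ∀ i, p i ω) := fun ω ω' hω => by
  simp only [fun i => h i ω ω' hω]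

/-! ### The coin tossing measure -/

/-- The law of independent fair coin tosses. -/
noncomputable def coin : Measure (ℕ → Bool) :=
  Measure.infinitePi fun _ : ℕ => (PMF.uniformOfFintype Bool).toMeasure

instance : IsProbabilityMeasure coin := by unfold coin; infer_instance

theorem P_eq : P = coin.map walk := rfl

/-- Reversal of the toss number `n`. -/
def flip (n : ℕ) (b : ℕ → Bool) (i : ℕ) : Bool := if i = n then !b i else b i

theorem map_not_uniform : (PMF.uniformOfFintype Bool).toMeasure.map not =
    (PMF.uniformOfFintype Bool).toMeasure := by
  refine Measure.ext_of_singleton fun b => ?_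
  rw [Measure.map_apply (measurable_of_countable _) (measurableSet_singleton _)]
  have : not ⁻¹' {b} = {!b} := by ext c; cases b <;> cases c <;> simp
  rw [this, PMF.toMeasure_apply_singleton _ _ (measurableSet_singleton _),
    PMF.toMeasure_apply_singleton _ _ (measurableSet_singleton _)]
  simp

theorem measurePreserving_flip (n : ℕ) : MeasurePreserving (flip n) coin coin := by
  have hm : ∀ i : ℕ, Measurable fun c : Bool => if i = n then !c else c :=
    fun i => measurable_of_countable _
  refine ⟨measurable_pi_lambda _ fun i => (hm i).comp (measurable_pi_apply i), ?_⟩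
  have := Measure.infinitePi_map_pi
    (μ := fun _ : ℕ => (PMF.uniformOfFintype Bool).toMeasure) hm
  unfold coin
  unfold flip
  rw [this]
  congr 1
  funext i
  by_cases h : i = n
  · simpa [h] using map_not_uniform
  · simp [h, Measure.map_id']

theorem X_walk (n : ℕ) (b : ℕ → Bool) : X n (walk b) = ∑ i ∈ Finset.range n, step (b i) := rfl

theorem X_zero_walk (b : ℕ → Bool) : X 0 (walk b) = 0 := by simp [X_walk]

theorem X_walk_congr {n : ℕ} {b b' : ℕ → Bool} (h : ∀ i < n, b i = b' i) {i : ℕ} (hi : i ≤ n) :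
    X i (walk b) = X i (walk b') := by
  rw [X_walk, X_walk]
  exact Finset.sum_congr rfl fun j hj => by rw [h j (by simp at hj; omega)]

theorem ae_X_zero : ∀ᵐ ω ∂P, X 0 ω = 0 := by
  have hm : MeasurableSet {ω | X 0 ω = 0} := measurable_X 0 (measurableSet_singleton 0)
  rw [P_eq, ae_map_iff measurable_walk.aemeasurable hm]
  exact ae_of_all _ X_zero_walk

theorem Det.exists_bound {n : ℕ} {F : Traj → ℝ} (h : Det n F) :
    ∃ C, ∀ b, |F (walk b)| ≤ C := by
  let e : (Fin n → Bool) → ℕ → Bool := fun b i => if hi : i < n then b ⟨i, hi⟩ else false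
  have hfin : (Set.range fun b : Fin n → Bool => |F (walk (e b))|).Finite := Set.finite_range _
  obtain ⟨C, hC⟩ := hfin.bddAbove
  refine ⟨C, fun b => ?_⟩
  have : F (walk b) = F (walk (e fun i => b i)) :=
    h _ _ fun i hi => X_walk_congr (fun j hj => by simp [e, hj]) hi
  rw [this]
  exact hC ⟨fun i => b i, rfl⟩

theorem Det.measurable' {β : Type*} [MeasurableSpace β] {n : ℕ} {F : Traj → β} (h : Det n F) :
    Measurable F := h.measurable.mono (ℱ.le n) le_rfl

theorem Det.integrable {n : ℕ} {F : Traj → ℝ} (h : Det n F) : Integrable F P := by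
  obtain ⟨C, hC⟩ := h.exists_bound
  rw [P_eq, integrable_map_measure h.measurable'.aestronglyMeasurable
    measurable_walk.aemeasurable]
  refine Integrable.of_bound (h.measurable'.comp measurable_walk).aestronglyMeasurable C
    (ae_of_all _ fun b => ?_)
  simpa using hC b

theorem step_not (b : Bool) : step (!b) = - step b := by cases b <;> simp [step]

/-- One step of the random walk. -/
theorem setIntegral_step {n : ℕ} {Λ : Set Traj} {F G : Traj → ℝ} (hΛ : MeasurableSet[ℱ n] Λ)
    (hF : Det (n + 1) F) (hG : Det n G)
    (h : ∀ ω ω₁ ω₂, ω ∈ Λ → X 0 ω = 0 → (∀ i ≤ n, X i ω₁ = X i ω) → (∀ i ≤ n, X i ω₂ = X i ω) →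
      X (n + 1) ω₁ = X n ω + 1 → X (n + 1) ω₂ = X n ω - 1 → F ω₁ + F ω₂ = 2 * G ω) :
    ∫ ω in Λ, F ω ∂P = ∫ ω in Λ, G ω ∂P := by
  classical
  have hm := measurableSet_of_filtration hΛ
  have hdΛ := det_of_measurableSet hΛ
  have hdet : ∀ {m} (_ : n ≤ m) {F : Traj → ℝ}, Det m F → Det m (Λ.indicator F) := by
    intro m hnm F hF ω ω' hω
    have h1 := (hdΛ.mono hnm) ω ω' hω
    have h2 := hF ω ω' hω
    simp only [Set.indicator, h2, h1]
  have hF' := hdet (Nat.le_succ n) hF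
  have hG' := hdet le_rfl hG
  rw [← integral_indicator hm, ← integral_indicator hm, P_eq,
    integral_map measurable_walk.aemeasurable hF'.measurable'.aestronglyMeasurable,
    integral_map measurable_walk.aemeasurable hG'.measurable'.aestronglyMeasurable]
  have hint : ∀ {m} {F : Traj → ℝ}, Det m F → Integrable (fun b => F (walk b)) coin := by
    intro m F hF
    have := hF.integrable
    rwa [P_eq, integrable_map_measure hF.measurable'.aestronglyMeasurable
      measurable_walk.aemeasurable] at this
  have hflip : ∫ b, Λ.indicator F (walk (flip n b)) ∂coin = ∫ b, Λ.indicator F (walk b) ∂coin := by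
    have hi := hint hF'
    have hm := (measurePreserving_flip n).map_eq
    have := integral_map (measurePreserving_flip n).measurable.aemeasurable
      (f := fun b => Λ.indicator F (walk b)) (by rw [hm]; exact hi.1)
    rw [← this, hm]
  have hkey : ∀ b, Λ.indicator F (walk b) + Λ.indicator F (walk (flip n b)) =
      2 * Λ.indicator G (walk b) := by
    intro b
    have hX : ∀ i ≤ n, X i (walk (flip n b)) = X i (walk b) := fun i hi =>
      X_walk_congr (fun j hj => by simp [flip, hj.ne]) hi
    have hΛ' : walk (flip n b) ∈ Λ ↔ walk b ∈ Λ := iff_of_eq (hdΛ _ _ hX)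
    by_cases hb : walk b ∈ Λ
    · rw [Set.indicator_of_mem hb, Set.indicator_of_mem hb, Set.indicator_of_mem (hΛ'.2 hb)]
      have h1 : X (n + 1) (walk b) = X n (walk b) + step (b n) := by
        simp only [X_walk, Finset.sum_range_succ]
      have h2 : X (n + 1) (walk (flip n b)) = X n (walk b) - step (b n) := by
        rw [← hX n le_rfl]
        simp only [X_walk, Finset.sum_range_succ]
        simp [flip, step_not, sub_eq_add_neg]
      cases hbn : b n
      · rw [add_comm]
        refine h _ _ _ hb (X_zero_walk b) hX (fun _ _ => rfl) ?_ ?_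
        · rw [h2, hbn]; simp [step]
        · rw [h1, hbn]; simp [step]; ring
      · refine h _ _ _ hb (X_zero_walk b) (fun _ _ => rfl) hX ?_ ?_
        · rw [h1, hbn]; simp [step]
        · rw [h2, hbn]; simp [step]
    · rw [Set.indicator_of_notMem hb, Set.indicator_of_notMem hb,
        Set.indicator_of_notMem (fun h => hb (hΛ'.1 h))]
      simp
  have hi1 := hint hF'
  have hi2 : Integrable (fun b => Λ.indicator F (walk (flip n b))) coin :=
    (measurePreserving_flip n).integrable_comp_of_integrable hi1
  have : ∫ b, Λ.indicator F (walk b) ∂coin + ∫ b, Λ.indicator F (walk (flip n b)) ∂coin =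
      2 * ∫ b, Λ.indicator G (walk b) ∂coin := by
    rw [← integral_add hi1 hi2, ← integral_const_mul]
    exact integral_congr_ae (ae_of_all _ hkey)
  linarith

/-! ### The functionals of the path -/

theorem abs_X_succ_sub (n : ℕ) (ω : Traj) : |X (n + 1) ω - X n ω| = 1 := ω.2 n

theorem X_succ_cases (n : ℕ) (ω : Traj) : X (n + 1) ω = X n ω + 1 ∨ X (n + 1) ω = X n ω - 1 := by
  have := abs_X_succ_sub n ω
  rcases abs_eq (zero_le_one' ℤ) |>.1 this with h | h <;> omega

theorem S_zero (ω : Traj) : S 0 ω = X 0 ω := by simp [S]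

theorem S_succ (n : ℕ) (ω : Traj) : S (n + 1) ω = max (S n ω) (X (n + 1) ω) := by
  unfold S
  apply le_antisymm
  · refine Finset.sup'_le _ _ fun i hi => ?_
    rw [Finset.mem_range] at hi
    rcases Nat.lt_succ_iff_lt_or_eq.1 hi with h | rfl
    · exact le_max_of_le_left (Finset.le_sup' (fun k => X k ω) (Finset.mem_range.2 h))
    · exact le_max_right _ _
  · refine max_le (Finset.sup'_mono _ (Finset.range_subset_range.2 (by omega)) _) ?_
    exact Finset.le_sup' (fun k => X k ω) (Finset.mem_range.2 (by omega))

theorem X_le_S (n : ℕ) (ω : Traj) : X n ω ≤ S n ω :=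
  Finset.le_sup' (fun k => X k ω) (Finset.mem_range.2 (by omega))

theorem S_mono (ω : Traj) : Monotone fun n => S n ω :=
  monotone_nat_of_le_succ fun n => by rw [S_succ]; exact le_max_left _ _

theorem S_nonneg {ω : Traj} (h : X 0 ω = 0) (n : ℕ) : 0 ≤ S n ω := by
  have := S_mono ω (Nat.zero_le n)
  simp only [S_zero, h] at this
  exact this

theorem abs_X_le {ω : Traj} (h : X 0 ω = 0) (n : ℕ) : |X n ω| ≤ n := by
  induction n with
  | zero => simp [h]
  | succ n ih =>
    rw [abs_le] at ih ⊢
    push_cast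
    rcases X_succ_cases n ω with h | h <;> omega

theorem S_le {ω : Traj} (h : X 0 ω = 0) (n : ℕ) : S n ω ≤ n := by
  induction n with
  | zero => simp [S_zero, h]
  | succ n ih =>
    rw [S_succ]
    have := (abs_le.1 (abs_X_le h (n + 1))).2
    push_cast at this ⊢
    omega

theorem det_S {i n : ℕ} (hi : i ≤ n) : Det n (S i) := fun ω ω' h => by
  unfold S
  refine Finset.sup'_congr _ rfl fun j hj => h j ?_
  simp at hj; omega

theorem γ_zero {ω : Traj} (h : X 0 ω = 0) : γ 0 ω = 1 := by
  simp [γ, h, Finset.filter_singleton]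

theorem γ_succ (n : ℕ) (ω : Traj) :
    γ (n + 1) ω = γ n ω + if X (n + 1) ω = 0 then 1 else 0 := by
  unfold γ
  rw [Finset.range_add_one, Finset.filter_insert]
  split_ifs with h
  · rw [Finset.card_insert_of_notMem (by simp)]
  · rfl

theorem γ_mono (ω : Traj) : Monotone fun n => γ n ω :=
  monotone_nat_of_le_succ fun n => by rw [γ_succ]; exact Nat.le_add_right _ _

theorem det_γ {i n : ℕ} (hi : i ≤ n) : Det n (γ i) := fun ω ω' h => by
  unfold γ
  congr 1
  refine Finset.filter_congr fun j hj => ?_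
  rw [h j (by simp at hj; omega)]

/-- The maximum up to the last zero before `n`. -/
def Sg (n : ℕ) (ω : Traj) : ℤ := S (lastZeroBefore n ω) ω

theorem Sg_zero (ω : Traj) : Sg 0 ω = S 0 ω := by simp [Sg, lastZeroBefore]

theorem Sg_succ (n : ℕ) (ω : Traj) :
    Sg (n + 1) ω = if X (n + 1) ω = 0 then S (n + 1) ω else Sg n ω := by
  unfold Sg lastZeroBefore
  rw [Nat.findGreatest_succ]
  split_ifs <;> rfl

theorem Sg_of_zero {n : ℕ} {ω : Traj} (h : X n ω = 0) : Sg n ω = S n ω := by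
  cases n with
  | zero => exact Sg_zero ω
  | succ n => rw [Sg_succ, if_pos h]

theorem det_Sg {i n : ℕ} (hi : i ≤ n) : Det n (Sg i) := by
  intro ω ω' h
  induction i with
  | zero => rw [Sg_zero, Sg_zero]; exact det_S hi ω ω' h
  | succ i ih =>
    rw [Sg_succ, Sg_succ, ih (by omega), det_S hi ω ω' h, h _ hi]

/-! ### The expected sign of the simple random walk -/

/-- The expectation of the sign of the position at time `m` of the simple random walk started
at `y`. -/
noncomputable def meanSign : ℕ → ℤ → ℝ
  | 0, y => (Int.sign y : ℝ)
  | m + 1, y => (meanSign m (y - 1) + meanSign m (y + 1)) / 2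

theorem meanSign_succ (m : ℕ) (y : ℤ) :
    meanSign (m + 1) y = (meanSign m (y - 1) + meanSign m (y + 1)) / 2 := rfl

theorem meanSign_neg (m : ℕ) (y : ℤ) : meanSign m (-y) = - meanSign m y := by
  induction m generalizing y with
  | zero => simp [meanSign]
  | succ m ih =>
    rw [meanSign_succ, meanSign_succ, ← neg_add', ih (y + 1),
      show -y + 1 = -(y - 1) by ring, ih (y - 1)]
    ring

theorem meanSign_zero_right (m : ℕ) : meanSign m 0 = 0 := by
  have := meanSign_neg m 0
  simp at this
  linarith

theorem abs_meanSign_le (m : ℕ) (y : ℤ) : |meanSign m y| ≤ 1 := by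
  induction m generalizing y with
  | zero =>
    rcases lt_trichotomy y 0 with h | rfl | h
    · simp [meanSign, Int.sign_eq_neg_one_of_neg h]
    · simp [meanSign]
    · simp [meanSign, Int.sign_eq_one_of_pos h]
  | succ m ih =>
    have h1 := abs_le.1 (ih (y - 1))
    have h2 := abs_le.1 (ih (y + 1))
    rw [meanSign_succ, abs_le]
    constructor <;> linarith

/-- The transition probabilities of the simple random walk: the probability to be at `j` at time
`m`. -/
noncomputable def walkProb : ℕ → ℤ → ℝ
  | 0, j => if j = 0 then 1 else 0
  | m + 1, j => (walkProb m (j - 1) + walkProb m (j + 1)) / 2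

theorem walkProb_succ (m : ℕ) (j : ℤ) :
    walkProb (m + 1) j = (walkProb m (j - 1) + walkProb m (j + 1)) / 2 := rfl

theorem walkProb_nonneg (m : ℕ) (j : ℤ) : 0 ≤ walkProb m j := by
  induction m generalizing j with
  | zero => unfold walkProb; split_ifs <;> norm_num
  | succ m ih => rw [walkProb_succ]; have := ih (j - 1); have := ih (j + 1); positivity

theorem walkProb_ratio (m : ℕ) (j : ℤ) :
    ((m : ℝ) - j) * walkProb m j = (m + j + 2) * walkProb m (j + 2) := by
  induction m generalizing j with
  | zero =>
    by_cases h0 : j = 0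
    · subst h0; simp [walkProb]
    · by_cases h2 : j + 2 = 0
      · obtain rfl : j = -2 := by omega
        simp [walkProb]
      · simp [walkProb, h0, h2]
  | succ m ih =>
    have h1 := ih (j - 1)
    have h2 := ih (j + 1)
    rw [walkProb_succ, walkProb_succ]
    rw [show j - 1 + 2 = j + 1 by ring] at h1
    rw [show j + 1 + 2 = j + 2 + 1 by ring] at h2
    rw [show j + 2 - 1 = j + 1 by ring]
    push_cast at *
    linear_combination (h1 + h2) / 2

theorem meanSign_add_one_sub (m : ℕ) (y : ℤ) :
    meanSign m (y + 1) - meanSign m y = walkProb m y + walkProb m (y + 1) := by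
  induction m generalizing y with
  | zero =>
    rcases lt_trichotomy y (-1) with h | rfl | h
    · simp only [meanSign, walkProb]
      rw [Int.sign_eq_neg_one_of_neg (by omega), Int.sign_eq_neg_one_of_neg (by omega),
        if_neg (by omega), if_neg (by omega)]
      simp
    · simp [meanSign, walkProb]
    · rcases eq_or_lt_of_le (show 0 ≤ y by omega) with rfl | h
      · simp [meanSign, walkProb]
      · simp only [meanSign, walkProb]
        rw [Int.sign_eq_one_of_pos (by omega), Int.sign_eq_one_of_pos (by omega),
          if_neg (by omega), if_neg (by omega)]
        simp
  | succ m ih =>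
    have h1 := ih (y - 1)
    have h2 := ih (y + 1)
    simp only [meanSign_succ, walkProb_succ]
    simp only [sub_add_cancel, add_sub_cancel_right] at *
    linarith

theorem meanSign_mono (m : ℕ) : Monotone (meanSign m) :=
  monotone_int_of_le_succ fun y => by
    have := meanSign_add_one_sub m y
    have := walkProb_nonneg m y
    have := walkProb_nonneg m (y + 1)
    linarith

theorem meanSign_nonneg (m : ℕ) {y : ℤ} (hy : 0 ≤ y) : 0 ≤ meanSign m y := by
  rw [← meanSign_zero_right m]
  exact meanSign_mono m hy

/-- The increments of `meanSign m` decrease on the nonnegative integers. -/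
theorem meanSign_concave (m : ℕ) {y : ℤ} (hy : 0 ≤ y) :
    meanSign m (y + 2) - meanSign m (y + 1) ≤ meanSign m (y + 1) - meanSign m y := by
  induction m generalizing y with
  | zero =>
    rcases eq_or_lt_of_le hy with rfl | h
    · norm_num [meanSign]
      norm_num [show Int.sign 2 = 1 from rfl]
    · simp only [meanSign]
      rw [Int.sign_eq_one_of_pos (by omega), Int.sign_eq_one_of_pos (by omega),
        Int.sign_eq_one_of_pos h]
  | succ m ih =>
    simp only [meanSign_succ]
    have h2 := @ih (y + 1) (by omega)
    rw [show y + 1 + 2 = y + 2 + 1 by ring, show y + 1 + 1 = y + 2 by ring] at h2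
    rw [show y + 2 - 1 = y + 1 by ring, show y + 1 - 1 = y by ring,
      show y + 1 + 1 = y + 2 by ring]
    rcases eq_or_lt_of_le hy with rfl | h
    · have h3 := meanSign_neg m 1
      have h4 := meanSign_zero_right m
      norm_num at *
      linarith
    · have h1 := @ih (y - 1) (by omega)
      rw [show y - 1 + 2 = y + 1 by ring, show y - 1 + 1 = y by ring] at h1
      linarith

theorem meanSign_add_one_sub_le (m : ℕ) {y : ℤ} (hy : 0 ≤ y) :
    meanSign m (y + 1) - meanSign m y ≤ meanSign m 1 := by
  induction y, hy using Int.leInduction with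
  | base => simp [meanSign_zero_right]
  | succ y hy ih =>
    have := meanSign_concave m hy
    rw [show y + 1 + 1 = y + 2 by ring]
    linarith

theorem abs_meanSign_add_two_sub_le (m : ℕ) (y : ℤ) :
    |meanSign m (y + 2) - meanSign m y| ≤ 2 * meanSign m 1 := by
  have key : ∀ y : ℤ, meanSign m (y + 1) - meanSign m y ≤ meanSign m 1 := by
    intro y
    rcases le_or_gt 0 y with hy | hy
    · exact meanSign_add_one_sub_le m hy
    · have h := meanSign_add_one_sub_le m (show 0 ≤ -y - 1 by omega)
      rw [show -y - 1 + 1 = -y by ring, show -y - 1 = -(y + 1) by ring, meanSign_neg,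
        meanSign_neg] at h
      linarith
  have h1 := key y
  have h2 := key (y + 1)
  rw [add_assoc, show (1 : ℤ) + 1 = 2 by norm_num] at h2
  have h3 := meanSign_mono m (show y ≤ y + 2 by omega)
  rw [abs_le]
  constructor <;> linarith

theorem meanSign_le_mul (m : ℕ) {y : ℤ} (hy : 0 ≤ y) : meanSign m y ≤ y * meanSign m 1 := by
  induction y, hy using Int.leInduction with
  | base => simp [meanSign_zero_right]
  | succ y hy ih =>
    have := meanSign_add_one_sub_le m hy
    push_cast
    linarith

theorem meanSign_one_pos (m : ℕ) : 0 < meanSign m 1 := by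
  induction m with
  | zero => simp [meanSign]
  | succ m ih =>
    have := meanSign_mono m (show (1 : ℤ) ≤ 2 by norm_num)
    rw [meanSign_succ]
    norm_num [meanSign_zero_right]
    linarith

theorem tendsto_meanSign_two_div :
    Tendsto (fun m => meanSign m 2 / meanSign m 1) atTop (𝓝 2) := by
  have hlim : Tendsto (fun m : ℕ => 2 - 2 / ((m : ℝ) + 2)) atTop (𝓝 2) := by
    have : Tendsto (fun m : ℕ => (2 : ℝ) / ((m : ℝ) + 2)) atTop (𝓝 0) :=
      Tendsto.const_div_atTop (tendsto_atTop_add_const_right _ _ tendsto_natCast_atTop_atTop) _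
    simpa using tendsto_const_nhds.sub this
  refine tendsto_of_tendsto_of_tendsto_of_le_of_le hlim tendsto_const_nhds
    (fun m => ?_) (fun m => ?_)
  · have hpos := meanSign_one_pos m
    have h0 := meanSign_add_one_sub m 0
    have h1 := meanSign_add_one_sub m 1
    have h2 := walkProb_ratio m 0
    have hp0 := walkProb_nonneg m 0
    have hp1 := walkProb_nonneg m 1
    have hp2 := walkProb_nonneg m 2
    have hm : (0 : ℝ) < m + 2 := by positivity
    norm_num [meanSign_zero_right] at h0 h1 h2
    simp only
    rw [le_div_iff₀ hpos]
    have h3 : meanSign m 2 = walkProb m 0 + 2 * walkProb m 1 + walkProb m 2 := by linarith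
    have h4 : walkProb m 2 = m / (m + 2) * walkProb m 0 := by
      field_simp; linarith
    have h5 : (m : ℝ) / (m + 2) = 1 - 2 / (m + 2) := by field_simp; ring
    rw [h3, h4, h5, h0]
    have : 0 ≤ 2 / ((m : ℝ) + 2) * walkProb m 1 := by positivity
    nlinarith
  · simp only
    rw [div_le_iff₀ (meanSign_one_pos m)]
    have := meanSign_le_mul m (show (0 : ℤ) ≤ 2 by norm_num)
    simpa using this

theorem tendsto_meanSign_one_succ_div :
    Tendsto (fun m => meanSign (m + 1) 1 / meanSign m 1) atTop (𝓝 1) := by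
  have h := tendsto_meanSign_two_div.div_const 2
  norm_num at h
  refine h.congr fun m => ?_
  rw [meanSign_succ]
  norm_num [meanSign_zero_right]
  ring

theorem tendsto_meanSign_natCast_div (y : ℕ) :
    Tendsto (fun m => meanSign m y / meanSign m 1) atTop (𝓝 y) := by
  induction y using Nat.strong_induction_on with
  | _ y ih =>
    rcases y with _ | _ | y
    · simp [meanSign_zero_right]
    · simpa using tendsto_const_nhds.congr fun m => (div_self (meanSign_one_pos m).ne').symm
    · have h1 := ih (y + 1) (by omega)
      have h2 := ih y (by omega)
      have h3 := (((tendsto_add_atTop_iff_nat 1).2 h1).mul tendsto_meanSign_one_succ_div).const_mul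
        2 |>.sub h2
      have : (2 : ℝ) * (((y + 1 : ℕ) : ℝ) * 1) - y = ((y + 1 + 1 : ℕ) : ℝ) := by
        push_cast; ring
      rw [this] at h3
      refine h3.congr fun m => ?_
      rw [div_mul_div_cancel₀ (meanSign_one_pos _).ne', meanSign_succ]
      push_cast
      rw [show (y : ℤ) + 1 - 1 = y by ring]
      ring

theorem tendsto_meanSign_div (y : ℤ) :
    Tendsto (fun m => meanSign m y / meanSign m 1) atTop (𝓝 y) := by
  rcases Int.natAbs_eq y with h | h
  · rw [h]; exact tendsto_meanSign_natCast_div y.natAbs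
  · rw [h]
    simp only [meanSign_neg, neg_div]
    push_cast
    simpa using (tendsto_meanSign_natCast_div y.natAbs).neg

theorem tendsto_meanSign_one : Tendsto (fun m => meanSign m 1) atTop (𝓝 0) := by
  rw [Metric.tendsto_atTop]
  intro ε hε
  obtain ⟨y, hy⟩ := exists_nat_gt (1 / ε + 1)
  have hy' : 1 / ε < y := by linarith
  obtain ⟨N, hN⟩ := eventually_atTop.1
    ((tendsto_meanSign_natCast_div y).eventually (lt_mem_nhds hy'))
  refine ⟨N, fun m hm => ?_⟩
  have hpos := meanSign_one_pos m
  have h1 := hN m hm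
  rw [div_lt_div_iff₀ hε hpos] at h1
  have h2 := (abs_le.1 (abs_meanSign_le m y)).2
  rw [Real.dist_eq, sub_zero, abs_of_pos hpos]
  nlinarith

theorem tendsto_meanSign (y : ℤ) : Tendsto (fun m => meanSign m y) atTop (𝓝 0) := by
  have := (tendsto_meanSign_div y).mul tendsto_meanSign_one
  rw [mul_zero] at this
  exact this.congr fun m => div_mul_cancel₀ _ (meanSign_one_pos m).ne'

/-! ### Harmonic functions of `(X, S, S_g)` -/

/-- The part of `pot` that depends only on the position and on the maximum. -/
noncomputable def potMax (φ : ℕ → ℝ) (k : ℤ → ℝ) (x : ℤ) (s : ℕ) : ℝ :=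
  φ s * k (2 * s + 2 - x) +
    ∑' j : ℕ, φ (s + 1 + j) *
      (k (2 * ((s + 1 + j : ℕ) : ℤ) - x + 2) - k (2 * ((s + 1 + j : ℕ) : ℤ) - x))

/-- The function of the position `x`, the maximum `s` and the maximum `σ` up to the last zero
attached to a function `k`. -/
noncomputable def pot (φ : ℕ → ℝ) (k : ℤ → ℝ) (x : ℤ) (s σ : ℕ) : ℝ :=
  (φ σ - φ s) * k |x| + potMax φ k x s

section

variable {φ : ℕ → ℝ} {k : ℤ → ℝ} {C : ℝ}

theorem summable_potMax (hφ : Summable φ) (h0 : ∀ k, 0 ≤ φ k) (hk : ∀ y, |k (y + 2) - k y| ≤ C)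
    (x : ℤ) (s : ℕ) :
    Summable fun j : ℕ => φ (s + j) *
      (k (2 * ((s + j : ℕ) : ℤ) - x + 2) - k (2 * ((s + j : ℕ) : ℤ) - x)) := by
  have hs : Summable fun j : ℕ => φ (s + j) * C :=
    (hφ.comp_injective (add_right_injective s)).mul_right C
  refine Summable.of_norm_bounded hs fun j => ?_
  rw [norm_mul, Real.norm_of_nonneg (h0 _)]
  exact mul_le_mul_of_nonneg_left (hk _) (h0 _)

theorem potMax_avg (hφ : Summable φ) (h0 : ∀ k, 0 ≤ φ k) (hk : ∀ y, |k (y + 2) - k y| ≤ C)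
    (x : ℤ) (s : ℕ) :
    potMax φ k (x + 1) s + potMax φ k (x - 1) s =
      2 * potMax φ (fun y => (k (y - 1) + k (y + 1)) / 2) x s := by
  have h1 := summable_potMax hφ h0 hk (x + 1) (s + 1)
  have h2 := summable_potMax hφ h0 hk (x - 1) (s + 1)
  have h3 := h1.tsum_add h2
  unfold potMax
  rw [mul_add 2, ← tsum_mul_left, add_add_add_comm, ← h3]
  congr 1
  · rw [show (2 * s + 2 - (x + 1) : ℤ) = 2 * s + 2 - x - 1 by ring,
      show (2 * s + 2 - (x - 1) : ℤ) = 2 * s + 2 - x + 1 by ring]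
    ring
  · refine tsum_congr fun j => ?_
    generalize (2 * ((s + 1 + j : ℕ) : ℤ)) = t
    rw [show t - (x + 1) + 2 = t - x + 2 - 1 by ring, show t - (x - 1) + 2 = t - x + 2 + 1 by ring,
      show t - (x + 1) = t - x - 1 by ring, show t - (x - 1) = t - x + 1 by ring]
    ring

theorem potMax_succ (hφ : Summable φ) (h0 : ∀ k, 0 ≤ φ k) (hk : ∀ y, |k (y + 2) - k y| ≤ C)
    (s : ℕ) :
    potMax φ k (s + 1) s - potMax φ k (s + 1) (s + 1) = (φ s - φ (s + 1)) * k (s + 1) := by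
  have h := (summable_potMax hφ h0 hk (s + 1) (s + 1)).tsum_eq_zero_add
  unfold potMax
  rw [h, tsum_congr fun j => by rw [show s + 1 + (j + 1) = s + 1 + 1 + j by ring]]
  rw [show (2 * s + 2 - (s + 1) : ℤ) = s + 1 by ring,
    show (2 * ((s + 1 + 0 : ℕ) : ℤ) - (s + 1) + 2 : ℤ) =
      2 * ((s + 1 : ℕ) : ℤ) + 2 - (s + 1) by push_cast; ring,
    show (2 * ((s + 1 + 0 : ℕ) : ℤ) - (s + 1) : ℤ) = s + 1 by push_cast; ring]
  ring

theorem pot_zero (hk0 : k 0 = 0) (s σ : ℕ) : pot φ k 0 s σ = potMax φ k 0 s := by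
  simp [pot, hk0]

theorem pot_max (hφ : Summable φ) (h0 : ∀ k, 0 ≤ φ k) (hk : ∀ y, |k (y + 2) - k y| ≤ C)
    {x : ℤ} {s : ℕ} (hx : x ≤ s + 1) (σ : ℕ) :
    pot φ k x (max s x.toNat) σ = pot φ k x s σ := by
  rcases eq_or_lt_of_le hx with rfl | h
  · have h1 : max s ((s : ℤ) + 1).toNat = s + 1 := by omega
    have h2 := potMax_succ hφ h0 hk s
    have h3 : |(s : ℤ) + 1| = s + 1 := abs_of_nonneg (by positivity)
    rw [h1, pot, pot, h3]
    linarith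
  · rw [max_eq_left (by omega)]

theorem pot_step (hφ : Summable φ) (h0 : ∀ k, 0 ≤ φ k) (hk : ∀ y, |k (y + 2) - k y| ≤ C)
    (hk0 : k 0 = 0) {x : ℤ} {s σ : ℕ} (hx : x ≤ s) (hσ : x = 0 → σ = s) :
    pot φ k (x + 1) (max s (x + 1).toNat) (if x + 1 = 0 then max s (x + 1).toNat else σ) +
      pot φ k (x - 1) (max s (x - 1).toNat) (if x - 1 = 0 then max s (x - 1).toNat else σ) =
    2 * pot φ (fun y => (k (y - 1) + k (y + 1)) / 2) x s σ := by
  have key : ∀ z : ℤ, z ≤ s + 1 →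
      pot φ k z (max s z.toNat) (if z = 0 then max s z.toNat else σ) = pot φ k z s σ := by
    intro z hz
    rw [pot_max hφ h0 hk hz]
    split_ifs with h
    · subst h; rw [pot_zero hk0, pot_zero hk0]
    · rfl
  rw [key _ (by omega), key _ (by omega)]
  have havg := potMax_avg hφ h0 hk x s
  unfold pot
  rw [mul_add 2, ← havg]
  by_cases h : x = 0
  · subst h; rw [hσ rfl]; ring
  · rcases lt_or_gt_of_ne h with h | h
    · rw [abs_of_nonpos (show x + 1 ≤ 0 by omega), abs_of_neg (show x - 1 < 0 by omega),
        abs_of_neg h, show -(x + 1) = -x - 1 by ring, show -(x - 1) = -x + 1 by ring]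
      ring
    · rw [abs_of_pos (show 0 < x + 1 by omega), abs_of_nonneg (show 0 ≤ x - 1 by omega),
        abs_of_pos h]
      ring

/-- The value of `pot` along the path at time `n`. -/
noncomputable def potAt (φ : ℕ → ℝ) (k : ℤ → ℝ) (n : ℕ) (ω : Traj) : ℝ :=
  pot φ k (X n ω) (S n ω).toNat (Sg n ω).toNat

theorem det_potAt (φ : ℕ → ℝ) (k : ℤ → ℝ) {i n : ℕ} (hi : i ≤ n) : Det n (potAt φ k i) :=
  fun ω ω' h => by
    rw [potAt, potAt, det_X hi ω ω' h, det_S hi ω ω' h, det_Sg hi ω ω' h]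

theorem setIntegral_potAt_succ (hφ : Summable φ) (h0 : ∀ k, 0 ≤ φ k)
    (hk : ∀ y, |k (y + 2) - k y| ≤ C) (hk0 : k 0 = 0) {n : ℕ} {Λ : Set Traj}
    (hΛ : MeasurableSet[ℱ n] Λ) :
    ∫ ω in Λ, potAt φ k (n + 1) ω ∂P =
      ∫ ω in Λ, potAt φ (fun y => (k (y - 1) + k (y + 1)) / 2) n ω ∂P := by
  refine setIntegral_step hΛ (det_potAt _ _ le_rfl) (det_potAt _ _ le_rfl) ?_
  intro ω ω₁ ω₂ _ hX0 h1 h2 e1 e2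
  have hS := S_nonneg hX0 n
  have hXS := X_le_S n ω
  have hstep := pot_step (σ := (Sg n ω).toNat) (s := (S n ω).toNat) (x := X n ω) hφ h0 hk hk0
    (by omega) (fun h => by rw [Sg_of_zero h])
  have key : ∀ ω', (∀ i ≤ n, X i ω' = X i ω) → potAt φ k (n + 1) ω' =
      pot φ k (X (n + 1) ω') (max (S n ω).toNat (X (n + 1) ω').toNat)
        (if X (n + 1) ω' = 0 then max (S n ω).toNat (X (n + 1) ω').toNat
          else (Sg n ω).toNat) := by
    intro ω' h
    have hmax : (max (S n ω) (X (n + 1) ω')).toNat =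
        max (S n ω).toNat (X (n + 1) ω').toNat := by omega
    rw [potAt, S_succ, Sg_succ, S_succ, det_S le_rfl ω' ω h, det_Sg le_rfl ω' ω h, hmax,
      apply_ite Int.toNat, hmax]
  rw [key ω₁ h1, key ω₂ h2, e1, e2]
  exact hstep

end

/-! ### The martingale `M` -/

section

variable {φ : ℕ → ℝ}

theorem tail_succ (hφ : Summable φ) (s : ℕ) : tail φ s = φ s + tail φ (s + 1) := by
  have h := (hφ.comp_injective (add_right_injective s)).tsum_eq_zero_add
  simp only [Function.comp_def] at h
  rw [tail, h, add_zero, tail]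
  congr 1
  exact tsum_congr fun j => by rw [add_assoc, add_comm 1]

theorem tail_nonneg (h0 : ∀ k, 0 ≤ φ k) (s : ℕ) : 0 ≤ tail φ s := tsum_nonneg fun _ => h0 _

theorem tail_zero (hφ : HasSum φ 1) : tail φ 0 = 1 := by simp [tail, hφ.tsum_eq]

theorem tail_le_one (h0 : ∀ k, 0 ≤ φ k) (hφ : HasSum φ 1) (s : ℕ) : tail φ s ≤ 1 := by
  rw [← hφ.tsum_eq]
  exact tsum_comp_le_tsum_of_inj hφ.summable h0 (add_right_injective s)

theorem le_one_of_hasSum (h0 : ∀ k, 0 ≤ φ k) (hφ : HasSum φ 1) (k : ℕ) : φ k ≤ 1 :=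
  le_hasSum hφ k fun j _ => h0 j

/-- Half of the identity function. -/
noncomputable def half (y : ℤ) : ℝ := y / 2

theorem half_avg : (fun y : ℤ => (half (y - 1) + half (y + 1)) / 2) = half := by
  funext y; simp only [half]; push_cast; ring

theorem abs_half_add_two_sub (y : ℤ) : |half (y + 2) - half y| ≤ 1 := by
  simp only [half]; push_cast; ring_nf; simp

theorem M_eq_potAt (hφ : Summable φ) {ω : Traj} (hω : X 0 ω = 0) (n : ℕ) :
    M φ n ω = potAt φ half n ω := by
  have hS : (((S n ω).toNat : ℤ) : ℝ) = (S n ω : ℝ) := by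
    rw [Int.toNat_of_nonneg (S_nonneg hω n)]
  have htail : ∑' j : ℕ, φ ((S n ω).toNat + 1 + j) *
      (half (2 * (((S n ω).toNat + 1 + j : ℕ) : ℤ) - X n ω + 2) -
        half (2 * (((S n ω).toNat + 1 + j : ℕ) : ℤ) - X n ω)) =
      tail φ ((S n ω).toNat + 1) := by
    refine tsum_congr fun j => ?_
    simp only [half]; push_cast; ring
  rw [potAt, pot, potMax, htail]
  simp only [M, atMax, half]
  rw [tail_succ hφ]
  push_cast
  push_cast at hS
  rw [hS]
  change 1 / 2 * φ (Sg n ω).toNat * _ + _ + _ = _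
  rcases le_total 0 (X n ω) with h | h
  · have h' : (0 : ℝ) ≤ X n ω := by exact_mod_cast h
    rw [max_eq_left h', abs_of_nonneg h']
    ring
  · have h' : (X n ω : ℝ) ≤ 0 := by exact_mod_cast h
    rw [max_eq_right h', abs_of_nonpos h']
    ring

theorem det_M (φ : ℕ → ℝ) {i n : ℕ} (hi : i ≤ n) : Det n (M φ i) := fun ω ω' h => by
  have h1 : ∀ f : ℕ → ℝ, atMax f i ω = atMax f i ω' := fun f => by
    rw [atMax, atMax, det_S hi ω ω' h]
  have h2 : atMax φ (lastZeroBefore i ω) ω = atMax φ (lastZeroBefore i ω') ω' := by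
    have := det_Sg hi ω ω' h
    unfold Sg at this
    rw [atMax, atMax, this]
  rw [M, M, h1, h1, h2, det_X hi ω ω' h, det_S hi ω ω' h]

theorem M_nonneg (h0 : ∀ k, 0 ≤ φ k) {ω : Traj} (hω : X 0 ω = 0) (n : ℕ) : 0 ≤ M φ n ω := by
  have h1 : (0 : ℝ) ≤ S n ω := by exact_mod_cast S_nonneg hω n
  have h2 : (X n ω : ℝ) ≤ S n ω := by exact_mod_cast X_le_S n ω
  have h3 : (0 : ℝ) ≤ S n ω - max (X n ω : ℝ) 0 := sub_nonneg.2 (max_le h2 h1)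
  have h4 := h0 (S (lastZeroBefore n ω) ω).toNat
  have h5 := h0 (S n ω).toNat
  have h6 := tail_nonneg h0 (S n ω).toNat
  unfold M atMax
  positivity

theorem ae_M_nonneg (h0 : ∀ k, 0 ≤ φ k) : ∀ᵐ ω ∂P, ∀ n, 0 ≤ M φ n ω :=
  ae_X_zero.mono fun _ h n => M_nonneg h0 h n

theorem M_zero (hφ : HasSum φ 1) {ω : Traj} (hω : X 0 ω = 0) : M φ 0 ω = 1 := by
  simp [M, atMax, hω, S_zero, tail_zero hφ]

theorem setIntegral_M_succ (hφ : Summable φ) (h0 : ∀ k, 0 ≤ φ k) {n : ℕ} {Λ : Set Traj}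
    (hΛ : MeasurableSet[ℱ n] Λ) : ∫ ω in Λ, M φ (n + 1) ω ∂P = ∫ ω in Λ, M φ n ω ∂P := by
  have h := setIntegral_potAt_succ hφ h0 abs_half_add_two_sub (by simp [half]) hΛ
  rw [half_avg] at h
  have hM : ∀ n, ∫ ω in Λ, M φ n ω ∂P = ∫ ω in Λ, potAt φ half n ω ∂P := fun n =>
    integral_congr_ae (ae_restrict_of_ae (ae_X_zero.mono fun ω hω => M_eq_potAt hφ hω n))
  rw [hM, hM, h]

theorem setIntegral_M_of_le (hφ : Summable φ) (h0 : ∀ k, 0 ≤ φ k) {n m : ℕ} (hnm : n ≤ m)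
    {Λ : Set Traj} (hΛ : MeasurableSet[ℱ n] Λ) :
    ∫ ω in Λ, M φ m ω ∂P = ∫ ω in Λ, M φ n ω ∂P := by
  induction m, hnm using Nat.le_induction with
  | base => rfl
  | succ m hm ih => rw [setIntegral_M_succ hφ h0 (ℱ.mono hm _ hΛ), ih]

theorem martingale_M (hφ : Summable φ) (h0 : ∀ k, 0 ≤ φ k) : Martingale (M φ) ℱ P :=
  martingale_of_setIntegral_eq_succ (fun _ => (det_M φ le_rfl).measurable.stronglyMeasurable)
    (fun _ => (det_M φ le_rfl).integrable) fun _ _ hs => (setIntegral_M_succ hφ h0 hs).symm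

/-! ### The penalisation limit -/

theorem setIntegral_atMax_lastZeroBefore (hφ : Summable φ) (h0 : ∀ k, 0 ≤ φ k) (m : ℕ) {n : ℕ}
    {Λ : Set Traj} (hΛ : MeasurableSet[ℱ n] Λ) :
    ∫ ω in Λ, atMax φ (lastZeroBefore (m + n) ω) ω ∂P =
      ∫ ω in Λ, potAt φ (meanSign m) n ω ∂P := by
  induction m generalizing n with
  | zero =>
    refine integral_congr_ae (ae_restrict_of_ae (ae_X_zero.mono fun ω hω => ?_))
    have hS := S_nonneg hω n
    have hXS := X_le_S n ω
    simp only [zero_add]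
    change φ (Sg n ω).toNat = _
    rw [potAt, pot, potMax]
    have : ∀ j : ℕ, meanSign 0 (2 * (((S n ω).toNat + 1 + j : ℕ) : ℤ) - X n ω + 2) -
        meanSign 0 (2 * (((S n ω).toNat + 1 + j : ℕ) : ℤ) - X n ω) = 0 := by
      intro j
      simp only [meanSign]
      rw [Int.sign_eq_one_of_pos (by omega), Int.sign_eq_one_of_pos (by omega), sub_self]
    simp only [this, mul_zero, tsum_zero]
    have h1 : meanSign 0 (2 * ((S n ω).toNat : ℤ) + 2 - X n ω) = 1 := by
      simp only [meanSign]
      rw [Int.sign_eq_one_of_pos (by omega)]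
      simp
    rw [h1]
    by_cases hX : X n ω = 0
    · rw [Sg_of_zero hX]; simp
    · have h2 : meanSign 0 |X n ω| = 1 := by
        simp only [meanSign]
        rw [Int.sign_eq_one_of_pos (abs_pos.2 hX)]
        simp
      rw [h2]; ring
  | succ m ih =>
    have h1 := ih (n := n + 1) (ℱ.mono (Nat.le_succ n) _ hΛ)
    rw [show m + 1 + n = m + (n + 1) by ring, h1,
      setIntegral_potAt_succ hφ h0 (abs_meanSign_add_two_sub_le m) (meanSign_zero_right m) hΛ]
    rfl

theorem potMax_div (φ : ℕ → ℝ) (k : ℤ → ℝ) (c : ℝ) (x : ℤ) (s : ℕ) :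
    potMax φ (fun y => k y / c) x s = potMax φ k x s / c := by
  simp only [potMax, add_div, ← tsum_div_const]
  congr 1
  · ring
  · exact tsum_congr fun j => by ring

theorem pot_div (φ : ℕ → ℝ) (k : ℤ → ℝ) (c : ℝ) (x : ℤ) (s σ : ℕ) :
    pot φ (fun y => k y / c) x s σ = pot φ k x s σ / c := by
  rw [pot, pot, potMax_div]; ring

theorem abs_meanSign_div_le (m : ℕ) (y : ℤ) : |meanSign m y / meanSign m 1| ≤ |(y : ℝ)| := by
  have hpos := meanSign_one_pos m
  rw [abs_div, abs_of_pos hpos, div_le_iff₀ hpos]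
  rcases le_total 0 y with h | h
  · rw [abs_of_nonneg (meanSign_nonneg m h), abs_of_nonneg (by exact_mod_cast h)]
    exact meanSign_le_mul m h
  · have h1 := meanSign_nonneg m (neg_nonneg.2 h)
    have h2 := meanSign_le_mul m (neg_nonneg.2 h)
    rw [meanSign_neg] at h1 h2
    rw [abs_of_nonpos (by linarith), abs_of_nonpos (by exact_mod_cast h)]
    exact_mod_cast h2

theorem abs_meanSign_div_add_two_sub_le (m : ℕ) (y : ℤ) :
    |meanSign m (y + 2) / meanSign m 1 - meanSign m y / meanSign m 1| ≤ 2 := by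
  have hpos := meanSign_one_pos m
  rw [← sub_div, abs_div, abs_of_pos hpos, div_le_iff₀ hpos]
  exact abs_meanSign_add_two_sub_le m y

theorem tendsto_pot_meanSign_div (hφ : Summable φ) (h0 : ∀ k, 0 ≤ φ k) (x : ℤ) (s σ : ℕ) :
    Tendsto (fun m => pot φ (meanSign m) x s σ / meanSign m 1) atTop
      (𝓝 (2 * pot φ half x s σ)) := by
  have h2 : 2 * pot φ half x s σ = pot φ (fun y => (y : ℝ)) x s σ := by
    have := pot_div φ (fun y => (y : ℝ)) 2 x s σ
    change pot φ half x s σ = _ at this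
    rw [this]; ring
  rw [h2]
  simp only [← pot_div]
  unfold pot potMax
  refine ((tendsto_meanSign_div _).const_mul _).add
    (((tendsto_meanSign_div _).const_mul _).add ?_)
  refine tendsto_tsum_of_dominated_convergence (bound := fun j => φ (s + 1 + j) * 2)
    ((hφ.comp_injective (add_right_injective (s + 1))).mul_right 2)
    (fun j => ((tendsto_meanSign_div _).sub (tendsto_meanSign_div _)).const_mul _)
    (Eventually.of_forall fun m j => ?_)
  rw [norm_mul, Real.norm_of_nonneg (h0 _)]
  exact mul_le_mul_of_nonneg_left (abs_meanSign_div_add_two_sub_le m _) (h0 _)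

theorem abs_pot_meanSign_div_le (hφ : HasSum φ 1) (h0 : ∀ k, 0 ≤ φ k) (m : ℕ) (x : ℤ)
    (s σ : ℕ) : |pot φ (meanSign m) x s σ / meanSign m 1| ≤ 2 * |(x : ℝ)| + 2 * s + 4 := by
  rw [← pot_div]
  unfold pot potMax
  have h1 := abs_meanSign_div_le m |x|
  have h2 := abs_meanSign_div_le m (2 * s + 2 - x)
  have hσ := le_one_of_hasSum h0 hφ σ
  have hs := le_one_of_hasSum h0 hφ s
  have hσ0 := h0 σ
  have hs0 := h0 s
  have h3 : |∑' j : ℕ, φ (s + 1 + j) *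
      (meanSign m (2 * ((s + 1 + j : ℕ) : ℤ) - x + 2) / meanSign m 1 -
        meanSign m (2 * ((s + 1 + j : ℕ) : ℤ) - x) / meanSign m 1)| ≤ 2 := by
    have hsum : Summable fun j : ℕ => φ (s + 1 + j) * 2 :=
      (hφ.summable.comp_injective (add_right_injective (s + 1))).mul_right 2
    have := tsum_of_norm_bounded (f := fun j : ℕ => φ (s + 1 + j) *
      (meanSign m (2 * ((s + 1 + j : ℕ) : ℤ) - x + 2) / meanSign m 1 -
        meanSign m (2 * ((s + 1 + j : ℕ) : ℤ) - x) / meanSign m 1)) hsum.hasSum fun j => by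
      rw [norm_mul, Real.norm_of_nonneg (h0 _)]
      exact mul_le_mul_of_nonneg_left (abs_meanSign_div_add_two_sub_le m _) (h0 _)
    refine this.trans ?_
    rw [tsum_mul_right]
    have := tail_le_one h0 hφ (s + 1)
    rw [tail] at this
    linarith
  refine (abs_add_le _ _).trans ?_
  have h4 := abs_add_le (φ s * (meanSign m (2 * s + 2 - x) / meanSign m 1)) (∑' j : ℕ,
    φ (s + 1 + j) * (meanSign m (2 * ((s + 1 + j : ℕ) : ℤ) - x + 2) / meanSign m 1 -
        meanSign m (2 * ((s + 1 + j : ℕ) : ℤ) - x) / meanSign m 1))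
  have h5 : |(φ σ - φ s) * (meanSign m |x| / meanSign m 1)| ≤ |(x : ℝ)| := by
    rw [abs_mul]
    have : |φ σ - φ s| ≤ 1 := abs_le.2 ⟨by linarith, by linarith⟩
    rw [Int.cast_abs, abs_abs] at h1
    calc _ ≤ 1 * |(x : ℝ)| := mul_le_mul this h1 (abs_nonneg _) zero_le_one
      _ = _ := one_mul _
  have h6 : |φ s * (meanSign m (2 * s + 2 - x) / meanSign m 1)| ≤ 2 * s + 2 + |(x : ℝ)| := by
    rw [abs_mul, abs_of_nonneg hs0]
    have h7 : |((2 * s + 2 - x : ℤ) : ℝ)| ≤ 2 * s + 2 + |(x : ℝ)| := by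
      push_cast
      refine (abs_sub _ _).trans ?_
      rw [abs_of_nonneg (show (0 : ℝ) ≤ 2 * s + 2 by positivity)]
    calc _ ≤ 1 * (2 * s + 2 + |(x : ℝ)|) :=
          mul_le_mul hs (h2.trans h7) (abs_nonneg _) zero_le_one
      _ = _ := one_mul _
  linarith

theorem tendsto_setIntegral_potAt_div (hφ : HasSum φ 1) (h0 : ∀ k, 0 ≤ φ k) {n : ℕ}
    (Λ : Set Traj) :
    Tendsto (fun m => (∫ ω in Λ, potAt φ (meanSign m) n ω ∂P) / meanSign m 1) atTop
      (𝓝 (2 * ∫ ω in Λ, M φ n ω ∂P)) := by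
  have hM : ∫ ω in Λ, M φ n ω ∂P = ∫ ω in Λ, potAt φ half n ω ∂P :=
    integral_congr_ae (ae_restrict_of_ae
      (ae_X_zero.mono fun ω hω => M_eq_potAt hφ.summable hω n))
  rw [hM, ← integral_const_mul]
  simp only [← integral_div]
  refine tendsto_integral_of_dominated_convergence (fun _ => 4 * (n : ℝ) + 4) (fun m => ?_)
    (integrable_const _) (fun m => ae_restrict_of_ae (ae_X_zero.mono fun ω hω => ?_))
    (ae_of_all _ fun ω => tendsto_pot_meanSign_div hφ.summable h0 _ _ _)
  · exact (((det_potAt φ (meanSign m) (le_refl n)).comp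
      (· / meanSign m 1)).measurable').aestronglyMeasurable
  · refine (abs_pot_meanSign_div_le hφ h0 m _ _ _).trans ?_
    have h1 : |(X n ω : ℝ)| ≤ n := by exact_mod_cast abs_X_le hω n
    have h2 : ((S n ω).toNat : ℝ) ≤ n := by
      have := S_le hω n
      exact_mod_cast (show (S n ω).toNat ≤ n by omega)
    linarith

theorem penalisation_limit (hφ : HasSum φ 1) (h0 : ∀ k, 0 ≤ φ k) {n : ℕ} {Λ : Set Traj}
    (hΛ : MeasurableSet[ℱ n] Λ) :
    Tendsto (fun p : ℕ => (∫ ω in Λ, atMax φ (lastZeroBefore p ω) ω ∂P) /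
      (∫ ω, atMax φ (lastZeroBefore p ω) ω ∂P)) atTop (𝓝 (∫ ω in Λ, M φ n ω ∂P)) := by
  have hden : Tendsto (fun p : ℕ => (∫ ω, atMax φ (lastZeroBefore p ω) ω ∂P) / meanSign p 1)
      atTop (𝓝 2) := by
    have h := tendsto_setIntegral_potAt_div (n := 0) hφ h0 Set.univ
    have h1 : ∫ ω in Set.univ, M φ 0 ω ∂P = 1 := by
      rw [Measure.restrict_univ, integral_congr_ae
        (ae_X_zero.mono fun ω hω => M_zero hφ hω)]
      simp
    rw [h1, mul_one] at h
    refine h.congr fun m => ?_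
    have := setIntegral_atMax_lastZeroBefore hφ.summable h0 m (n := 0) MeasurableSet.univ
    rw [← this, Measure.restrict_univ, add_zero]
  have hratio : ∀ n : ℕ, Tendsto (fun m => meanSign (m + n) 1 / meanSign m 1) atTop (𝓝 1) := by
    intro n
    induction n with
    | zero => exact tendsto_const_nhds.congr fun m => (div_self (meanSign_one_pos m).ne').symm
    | succ n ih =>
      have h := ((tendsto_add_atTop_iff_nat n).2 tendsto_meanSign_one_succ_div).mul ih
      rw [one_mul] at h
      exact h.congr fun m => div_mul_div_cancel₀ (meanSign_one_pos _).ne'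
  rw [← tendsto_add_atTop_iff_nat n]
  have h := (tendsto_setIntegral_potAt_div (n := n) hφ h0 Λ).div
    (((tendsto_add_atTop_iff_nat n).2 hden).mul (hratio n)) (by norm_num)
  rw [mul_one, mul_div_cancel_left₀ _ two_ne_zero] at h
  refine h.congr fun m => ?_
  have h1 := (meanSign_one_pos m).ne'
  have h2 := (meanSign_one_pos (m + n)).ne'
  simp only [Pi.div_apply]
  rw [setIntegral_atMax_lastZeroBefore hφ.summable h0 m hΛ, div_mul_div_cancel₀ h2,
    div_div_div_cancel_right₀ h1]

end

/-! ### Existence and uniqueness of the penalised measure -/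

section

variable {φ : ℕ → ℝ}

theorem isClopen_walk_preimage {n : ℕ} {Λ : Set Traj} (hΛ : MeasurableSet[ℱ n] Λ) :
    IsClopen (walk ⁻¹' Λ) := by
  let e : (Fin n → Bool) → ℕ → Bool := fun b i => if hi : i < n then b ⟨i, hi⟩ else false
  have h : walk ⁻¹' Λ = (fun (b : ℕ → Bool) (i : Fin n) => b i) ⁻¹' {c | walk (e c) ∈ Λ} := by
    ext b
    exact iff_of_eq (det_of_measurableSet hΛ _ _ fun i hi =>
      X_walk_congr (fun j hj => by simp [e, hj]) hi)
  rw [h]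
  exact (isClopen_discrete _).preimage (by fun_prop)

theorem withDensity_apply_walk (h0 : ∀ k, 0 ≤ φ k) {Λ : Set Traj} (hΛ : MeasurableSet Λ)
    (n : ℕ) :
    coin.withDensity (fun b => ENNReal.ofReal (M φ n (walk b))) (walk ⁻¹' Λ) =
      ENNReal.ofReal (∫ ω in Λ, M φ n ω ∂P) := by
  have hM : Measurable fun ω => ENNReal.ofReal (M φ n ω) :=
    (det_M φ le_rfl).measurable'.ennreal_ofReal
  rw [withDensity_apply _ (measurable_walk hΛ), ofReal_integral_eq_lintegral_ofReal
    (det_M φ le_rfl).integrable.integrableOn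
    (ae_restrict_of_ae ((ae_M_nonneg h0).mono fun _ h => h n)), P_eq,
    setLIntegral_map hΛ hM measurable_walk]

theorem integral_M (hφ : HasSum φ 1) (h0 : ∀ k, 0 ≤ φ k) (n : ℕ) : ∫ ω, M φ n ω ∂P = 1 := by
  have h := setIntegral_M_of_le hφ.summable h0 (Nat.zero_le n) MeasurableSet.univ
  rw [Measure.restrict_univ, integral_congr_ae (ae_X_zero.mono fun ω hω => M_zero hφ hω)] at h
  simpa using h

theorem exists_isPenalised (hφ : HasSum φ 1) (h0 : ∀ k, 0 ≤ φ k) :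
    ∃ Q : Measure Traj, IsPenalised φ Q := by
  have hprob : ∀ n, IsProbabilityMeasure
      (coin.withDensity fun b => ENNReal.ofReal (M φ n (walk b))) := fun n => ⟨by
    have := withDensity_apply_walk h0 MeasurableSet.univ n
    rw [Set.preimage_univ] at this
    rw [this, Measure.restrict_univ, integral_M hφ h0, ENNReal.ofReal_one]⟩
  let q : ℕ → ProbabilityMeasure (ℕ → Bool) := fun n => ⟨_, hprob n⟩
  obtain ⟨μ, -, hμ⟩ := isCompact_univ.ultrafilter_le_nhds ((hyperfilter ℕ).map q) (by simp)
  have hlim : Tendsto q (hyperfilter ℕ) (𝓝 μ) := hμ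
  refine ⟨(μ : Measure (ℕ → Bool)).map walk,
    Measure.isProbabilityMeasure_map measurable_walk.aemeasurable, fun n Λ hΛ => ?_⟩
  have hm := measurableSet_of_filtration hΛ
  rw [Measure.map_apply measurable_walk hm]
  have hlim' := ProbabilityMeasure.tendsto_measure_of_null_frontier_of_tendsto' hlim
    (E := walk ⁻¹' Λ) (by rw [(isClopen_walk_preimage hΛ).frontier_eq]; simp)
  refine tendsto_nhds_unique hlim' (tendsto_const_nhds.congr' ?_)
  refine Filter.Eventually.filter_mono Nat.hyperfilter_le_atTop ?_
  filter_upwards [eventually_ge_atTop n] with m hmn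
  change _ = coin.withDensity (fun b => ENNReal.ofReal (M φ m (walk b))) (walk ⁻¹' Λ)
  rw [withDensity_apply_walk h0 hm, setIntegral_M_of_le hφ.summable h0 hmn hΛ]

theorem iSup_filtration :
    (⨆ n, (ℱ n : MeasurableSpace Traj)) = (inferInstance : MeasurableSpace Traj) := by
  refine le_antisymm (iSup_le fun n => ℱ.le n) ?_
  have h : Measurable[⨆ n, (ℱ n : MeasurableSpace Traj)] (Subtype.val : Traj → ℕ → ℤ) := by
    refine @measurable_pi_lambda _ _ _ (⨆ n, (ℱ n : MeasurableSpace Traj)) _ _ fun n => ?_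
    exact (det_X (le_refl n)).measurable.mono (le_iSup _ n) le_rfl
  exact measurable_iff_comap_le.1 h

theorem IsPenalised.unique {Q Q' : Measure Traj} (hQ : IsPenalised φ Q)
    (hQ' : IsPenalised φ Q') : Q = Q' := by
  have := hQ.isProbabilityMeasure
  have := hQ'.isProbabilityMeasure
  refine ext_of_generate_finite (⋃ n, {Λ | MeasurableSet[ℱ n] Λ}) ?_
    (isPiSystem_iUnion_of_monotone _ (fun n => (ℱ n).isPiSystem_measurableSet)
      fun _ _ h => ℱ.mono h) ?_ (by simp)
  · exact iSup_filtration.symm.trans (MeasurableSpace.generateFrom_iUnion_measurableSet _).symm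
  · intro Λ hΛ
    obtain ⟨n, hn⟩ := Set.mem_iUnion.1 hΛ
    rw [hQ.apply_eq n Λ hn, hQ'.apply_eq n Λ hn]

theorem existsUnique_isPenalised (hφ : HasSum φ 1) (h0 : ∀ k, 0 ≤ φ k) :
    ∃! Q : Measure Traj, IsPenalised φ Q := by
  obtain ⟨Q, hQ⟩ := exists_isPenalised hφ h0
  exact ⟨Q, hQ, fun Q' hQ' => hQ'.unique hQ⟩

end

/-! ### Paths without zeros after a fixed time -/

/-- There is no zero at the times `N + 1, …, N + m`. -/
def noZero (N m : ℕ) : Set Traj := {ω | ∀ i, N < i → i ≤ N + m → X i ω ≠ 0}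

/-- There is no zero after time `N`. -/
def noZeroAfter (N : ℕ) : Set Traj := {ω | ∀ i, N < i → X i ω ≠ 0}

theorem noZero_zero (N : ℕ) : noZero N 0 = Set.univ :=
  Set.eq_univ_of_forall fun _ _ h1 h2 => absurd h2 (by omega)

theorem noZero_succ (N m : ℕ) :
    noZero N (m + 1) = noZero N m ∩ {ω | X (N + m + 1) ω ≠ 0} := by
  ext ω
  constructor
  · exact fun h => ⟨fun i h1 h2 => h i h1 (by omega), h _ (by omega) (by omega)⟩
  · rintro ⟨h1, h2⟩ i h3 h4
    rcases Nat.lt_or_ge (N + m) i with h | h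
    · obtain rfl : i = N + m + 1 := by omega
      exact h2
    · exact h1 i h3 h

theorem noZero_succ' (N m : ℕ) :
    noZero N (m + 1) = {ω | X (N + 1) ω ≠ 0} ∩ noZero (N + 1) m := by
  ext ω
  constructor
  · exact fun h => ⟨h _ (by omega) (by omega), fun i h1 h2 => h i (by omega) (by omega)⟩
  · rintro ⟨h1, h2⟩ i h3 h4
    rcases Nat.lt_or_ge (N + 1) i with h | h
    · exact h2 i h (by omega)
    · obtain rfl : i = N + 1 := by omega
      exact h1

theorem iInter_noZero (N : ℕ) : ⋂ m, noZero N m = noZeroAfter N := by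
  ext ω
  simp only [Set.mem_iInter]
  exact ⟨fun h i hi => h i i hi (by omega), fun h m i hi _ => h i hi⟩

theorem measurableSet_X {n m : ℕ} (h : n ≤ m) (T : Set ℤ) :
    MeasurableSet[ℱ m] {ω | X n ω ∈ T} :=
  (det_X h).comp (· ∈ T) |>.measurableSet

theorem measurableSet_noZero (N m : ℕ) : MeasurableSet[ℱ (N + m)] (noZero N m) := by
  induction m with
  | zero => rw [noZero_zero]; exact MeasurableSet.univ
  | succ m ih =>
    rw [noZero_succ]
    exact (ℱ.mono (by omega) _ ih).inter (measurableSet_X (by omega) {x | x ≠ 0})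

theorem noZero_antitone (N : ℕ) : Antitone (noZero N) :=
  antitone_nat_of_succ_le fun m => by rw [noZero_succ]; exact Set.inter_subset_left

theorem measurableSet_noZeroAfter (N : ℕ) : MeasurableSet (noZeroAfter N) := by
  rw [← iInter_noZero]
  exact MeasurableSet.iInter fun m => measurableSet_of_filtration (measurableSet_noZero N m)

theorem sum_abs_neighbours (f : ℤ → ℝ) {x : ℤ} (hx : x ≠ 0) :
    f |x + 1| + f |x - 1| = f (|x| - 1) + f (|x| + 1) := by
  rcases lt_or_gt_of_ne hx with h | h
  · rw [abs_of_nonpos (show x + 1 ≤ 0 by omega), abs_of_neg (show x - 1 < 0 by omega),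
      abs_of_neg h, show -(x + 1) = -x - 1 by ring, show -(x - 1) = -x + 1 by ring]
  · rw [abs_of_pos (show 0 < x + 1 by omega), abs_of_nonneg (show 0 ≤ x - 1 by omega),
      abs_of_pos h, add_comm]

theorem setIntegral_inter_of_eq_zero {F : Traj → ℝ} {A B : Set Traj} (hA : MeasurableSet A)
    (hF : ∀ ω ∈ A, ω ∉ B → F ω = 0) : ∫ ω in A ∩ B, F ω ∂P = ∫ ω in A, F ω ∂P :=
  (setIntegral_eq_of_subset_of_forall_sdiff_eq_zero hA Set.inter_subset_left
    fun ω hω => hF ω hω.1 fun hB => hω.2 ⟨hω.1, hB⟩).symm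

theorem P_real_noZero (m : ℕ) {N : ℕ} {Λ : Set Traj} (hΛ : MeasurableSet[ℱ N] Λ)
    (hne : ∀ ω ∈ Λ, X N ω ≠ 0) :
    P.real (Λ ∩ noZero N m) = ∫ ω in Λ, meanSign m |X N ω| ∂P := by
  induction m generalizing N Λ with
  | zero =>
    rw [noZero_zero, Set.inter_univ, setIntegral_congr_fun (g := fun _ => 1)
      (measurableSet_of_filtration hΛ), setIntegral_const, smul_eq_mul, mul_one]
    intro ω hω
    simp only [meanSign]
    rw [Int.sign_eq_one_of_pos (abs_pos.2 (hne ω hω)), Int.cast_one]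
  | succ m ih =>
    have h1 := ih (N := N + 1) (Λ := Λ ∩ {ω | X (N + 1) ω ≠ 0})
      ((ℱ.mono (Nat.le_succ N) _ hΛ).inter (measurableSet_X le_rfl {x | x ≠ 0}))
      fun ω hω => hω.2
    rw [noZero_succ', ← Set.inter_assoc, h1, setIntegral_inter_of_eq_zero
      (measurableSet_of_filtration hΛ)]
    · refine setIntegral_step hΛ ((det_X le_rfl).comp fun x => meanSign m |x|)
        ((det_X le_rfl).comp fun x => meanSign (m + 1) |x|) ?_
      intro ω ω₁ ω₂ hω _ _ _ e1 e2
      simp only [e1, e2]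
      rw [sum_abs_neighbours _ (hne ω hω), meanSign_succ]
      ring
    · intro ω _ hω
      simp only [Set.mem_ofPred_eq, ne_eq, not_not] at hω
      rw [hω, abs_zero, meanSign_zero_right]

theorem tendsto_P_real_noZero {N : ℕ} {Λ : Set Traj} (hΛ : MeasurableSet[ℱ N] Λ)
    (hne : ∀ ω ∈ Λ, X N ω ≠ 0) :
    Tendsto (fun m => P.real (Λ ∩ noZero N m)) atTop (𝓝 0) := by
  simp only [P_real_noZero _ hΛ hne]
  have := tendsto_integral_of_dominated_convergence (μ := P.restrict Λ)
    (F := fun m ω => meanSign m |X N ω|) (f := fun _ => 0) (fun _ => 1)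
    (fun m => ((det_X (le_refl N)).comp fun x => meanSign m
      |x|).measurable'.aestronglyMeasurable)
    (integrable_const _) (fun m => ae_of_all _ fun ω => abs_meanSign_le _ _)
    (ae_of_all _ fun ω => tendsto_meanSign _)
  simpa using this

section

variable {φ : ℕ → ℝ}

theorem det_Sg_mul_abs (φ : ℕ → ℝ) {i j n : ℕ} (hi : i ≤ n) (hj : j ≤ n) :
    Det n fun ω => φ (Sg i ω).toNat * |(X j ω : ℝ)| :=
  (det_Sg hi).comp₂ (det_X hj) fun s x => φ s.toNat * |(x : ℝ)|

theorem setIntegral_noZero_Sg_mul_abs (φ : ℕ → ℝ) (m : ℕ) {N : ℕ} {Λ : Set Traj}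
    (hΛ : MeasurableSet[ℱ N] Λ) (hne : ∀ ω ∈ Λ, X N ω ≠ 0) :
    ∫ ω in Λ ∩ noZero N m, φ (Sg (N + m) ω).toNat * |(X (N + m) ω : ℝ)| ∂P =
      ∫ ω in Λ, φ (Sg N ω).toNat * |(X N ω : ℝ)| ∂P := by
  induction m with
  | zero => rw [noZero_zero, Set.inter_univ, add_zero]
  | succ m ih =>
    have hm : MeasurableSet[ℱ (N + m)] (Λ ∩ noZero N m) :=
      (ℱ.mono (by omega) _ hΛ).inter (measurableSet_noZero N m)
    rw [← ih, noZero_succ, ← Set.inter_assoc, setIntegral_inter_of_eq_zero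
      (measurableSet_of_filtration hm)]
    · refine setIntegral_step hm (det_Sg_mul_abs φ (by omega) (by omega))
        (det_Sg_mul_abs φ le_rfl le_rfl) ?_
      intro ω ω₁ ω₂ hω _ h1 h2 e1 e2
      have hX : X (N + m) ω ≠ 0 := by
        rcases Nat.eq_zero_or_pos m with rfl | h
        · exact hne ω hω.1
        · exact hω.2 _ (by omega) le_rfl
      have key : ∀ ω', (∀ i ≤ N + m, X i ω' = X i ω) →
          φ (Sg (N + (m + 1)) ω').toNat * |(X (N + (m + 1)) ω' : ℝ)| =
            φ (Sg (N + m) ω).toNat * |(X (N + m + 1) ω' : ℝ)| := by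
        intro ω' h
        rw [← add_assoc, Sg_succ, det_Sg le_rfl ω' ω h]
        split_ifs with h0
        · simp [h0]
        · rfl
      have h3 := sum_abs_neighbours (fun x => (x : ℝ)) hX
      rw [key _ h1, key _ h2, e1, e2]
      push_cast at h3 ⊢
      linear_combination φ (Sg (N + m) ω).toNat * h3
    · intro ω _ hω
      simp only [Set.mem_ofPred_eq, ne_eq, not_not] at hω
      rw [← add_assoc, hω]
      simp

theorem mul_le_tsum (h0 : ∀ k, 0 ≤ φ k) (hmean : Summable fun k : ℕ => (k : ℝ) * φ k) (k : ℕ) :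
    (k : ℝ) * φ k ≤ ∑' k : ℕ, (k : ℝ) * φ k :=
  hmean.le_tsum k fun j _ => mul_nonneg j.cast_nonneg (h0 j)

/-- Apart from its first term, `M` is bounded. -/
theorem abs_M_sub_le (hφ : HasSum φ 1) (h0 : ∀ k, 0 ≤ φ k)
    (hmean : Summable fun k : ℕ => (k : ℝ) * φ k) {ω : Traj} (hω : X 0 ω = 0) (n : ℕ) :
    |M φ n ω - 1 / 2 * (φ (Sg n ω).toNat * |(X n ω : ℝ)|)| ≤
      (∑' k : ℕ, (k : ℝ) * φ k) + 1 := by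
  have h1 : (0 : ℝ) ≤ S n ω := by exact_mod_cast S_nonneg hω n
  have h2 : (X n ω : ℝ) ≤ S n ω := by exact_mod_cast X_le_S n ω
  have h3 : (0 : ℝ) ≤ S n ω - max (X n ω : ℝ) 0 := sub_nonneg.2 (max_le h2 h1)
  have h5 := h0 (S n ω).toNat
  have h6 := tail_nonneg h0 (S n ω).toNat
  have h7 := tail_le_one h0 hφ (S n ω).toNat
  have h8 := mul_le_tsum h0 hmean (S n ω).toNat
  have hS : ((S n ω).toNat : ℝ) = (S n ω : ℝ) := by
    rw [← Int.cast_natCast, Int.toNat_of_nonneg (S_nonneg hω n)]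
  rw [hS] at h8
  have h9 : M φ n ω - 1 / 2 * (φ (Sg n ω).toNat * |(X n ω : ℝ)|) =
      φ (S n ω).toNat * ((S n ω : ℝ) - max (X n ω : ℝ) 0) + tail φ (S n ω).toNat := by
    simp only [M, atMax, Sg]; ring
  rw [h9, abs_of_nonneg (by positivity)]
  have h10 : φ (S n ω).toNat * max (X n ω : ℝ) 0 ≥ 0 := by positivity
  nlinarith

theorem IsPenalised.apply_noZeroAfter {Q : Measure Traj} (hQ : IsPenalised φ Q)
    (hφ : HasSum φ 1) (h0 : ∀ k, 0 ≤ φ k) (hmean : Summable fun k : ℕ => (k : ℝ) * φ k)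
    {N : ℕ} {Λ : Set Traj} (hΛ : MeasurableSet[ℱ N] Λ) (hne : ∀ ω ∈ Λ, X N ω ≠ 0) :
    Q (Λ ∩ noZeroAfter N) =
      ENNReal.ofReal (1 / 2 * ∫ ω in Λ, φ (Sg N ω).toNat * |(X N ω : ℝ)| ∂P) := by
  have := hQ.isProbabilityMeasure
  have hm : ∀ m, MeasurableSet[ℱ (N + m)] (Λ ∩ noZero N m) := fun m =>
    (ℱ.mono (by omega) _ hΛ).inter (measurableSet_noZero N m)
  have hlim : Tendsto (fun m => Q (Λ ∩ noZero N m)) atTop (𝓝 (Q (Λ ∩ noZeroAfter N))) := by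
    rw [← iInter_noZero, Set.inter_iInter]
    exact tendsto_measure_iInter_atTop
      (fun m => (measurableSet_of_filtration (hm m)).nullMeasurableSet)
      (fun i j hij => Set.inter_subset_inter_right _ (noZero_antitone N hij))
      ⟨0, measure_ne_top _ _⟩
  refine tendsto_nhds_unique hlim ?_
  simp only [fun m => hQ.apply_eq _ _ (hm m)]
  refine (ENNReal.continuous_ofReal.tendsto _).comp ?_
  rw [← sub_zero (1 / 2 * _), ← sub_zero (1 / 2 * _ - _)]
  set C := (∑' k : ℕ, (k : ℝ) * φ k) + 1
  have hrest : Tendsto (fun m => ∫ ω in Λ ∩ noZero N m,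
      (M φ (N + m) ω - 1 / 2 * (φ (Sg (N + m) ω).toNat * |(X (N + m) ω : ℝ)|)) ∂P)
      atTop (𝓝 0) := by
    have h1 := (tendsto_P_real_noZero hΛ hne).const_mul C
    rw [mul_zero] at h1
    refine squeeze_zero_norm (fun m => ?_) h1
    exact norm_setIntegral_le_of_norm_le_const_ae (measure_lt_top _ _)
      (ae_restrict_of_ae (ae_X_zero.mono fun ω hω => abs_M_sub_le hφ h0 hmean hω _))
  have hc : Tendsto (fun _ : ℕ => 1 / 2 * ∫ ω in Λ, φ (Sg N ω).toNat * |(X N ω : ℝ)| ∂P)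
      atTop (𝓝 (1 / 2 * ∫ ω in Λ, φ (Sg N ω).toNat * |(X N ω : ℝ)| ∂P)) := tendsto_const_nhds
  have h2 := hc.add hrest
  simp only [sub_zero]
  rw [add_zero] at h2
  refine h2.congr fun m => ?_
  have hi := (det_Sg_mul_abs φ (le_refl (N + m)) (le_refl (N + m))).integrable.const_mul
    (1 / 2 : ℝ) |>.integrableOn (s := Λ ∩ noZero N m)
  rw [integral_sub (det_M φ le_rfl).integrable.integrableOn hi, integral_const_mul,
    setIntegral_noZero_Sg_mul_abs φ m hΛ hne]
  ring

/-! ### The path after the last zero -/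

/-- The event that `ε X` takes the positive values `y 0, …, y n` at the times
`l + 1, …, l + 1 + n`. -/
def follows (ε : ℤ) (y : ℕ → ℤ) (l n : ℕ) : Set Traj :=
  {ω | ∀ i ≤ n, ε * X (l + 1 + i) ω = y i ∧ 1 ≤ y i}

theorem det_follows (ε : ℤ) (y : ℕ → ℤ) (l n : ℕ) :
    Det (l + 1 + n) fun ω => ω ∈ follows ε y l n :=
  Det.forall fun i ω ω' h => by
    by_cases hi : i ≤ n
    · simp only [h (l + 1 + i) (by omega)]
    · simp [hi]

theorem measurableSet_follows (ε : ℤ) (y : ℕ → ℤ) (l n : ℕ) :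
    MeasurableSet[ℱ (l + 1 + n)] (follows ε y l n) := (det_follows ε y l n).measurableSet

theorem follows_succ (ε : ℤ) (y : ℕ → ℤ) (l n : ℕ) :
    follows ε y l (n + 1) = follows ε y l n ∩
      {ω | ε * X (l + 1 + n + 1) ω = y (n + 1) ∧ 1 ≤ y (n + 1)} := by
  ext ω
  constructor
  · exact fun h => ⟨fun i hi => h i (by omega), h (n + 1) le_rfl⟩
  · rintro ⟨h1, h2⟩ i hi
    rcases Nat.lt_or_ge n i with h | h
    · obtain rfl : i = n + 1 := by omega
      exact h2
    · exact h1 i h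

theorem Sg_of_follows {ε : ℤ} {y : ℕ → ℤ} {l n : ℕ} {ω : Traj} (h : ω ∈ follows ε y l n) :
    Sg (l + 1 + n) ω = Sg l ω := by
  have hX : ∀ i ≤ n, X (l + 1 + i) ω ≠ 0 := fun i hi h0 => by
    have := h i hi
    rw [h0] at this
    omega
  induction n with
  | zero =>
    have := hX 0 le_rfl
    simp only [add_zero] at this ⊢
    rw [Sg_succ, if_neg this]
  | succ n ih =>
    have h1 : X (l + 1 + n + 1) ω ≠ 0 := hX (n + 1) le_rfl
    rw [← add_assoc, Sg_succ, if_neg h1]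
    exact ih (fun i hi => h i (by omega)) fun i hi => hX i (by omega)

/-- Integrating `|X|` over the paths that follow `ε y` after a zero gives the product of the
transition probabilities of the 3-Bessel* walk: it is the `h`-transform of the walk by `|x|`. -/
theorem setIntegral_follows {ε : ℤ} (hε : ε = 1 ∨ ε = -1) (y : ℕ → ℤ) {l : ℕ} {Λ : Set Traj}
    (hΛ : MeasurableSet[ℱ l] Λ) (h0 : ∀ ω ∈ Λ, X l ω = 0) {f : Traj → ℝ} (hf : Det l f)
    (n : ℕ) :
    ∫ ω in Λ ∩ follows ε y l n, f ω * |(X (l + 1 + n) ω : ℝ)| ∂P =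
      (∫ ω in Λ, f ω ∂P) * (1 / 2 * if y 0 = 1 then
        ∏ i ∈ Finset.range n, besselStar (y i) (y (i + 1)) else 0) := by
  classical
  have hεε : ε * ε = 1 := by rcases hε with rfl | rfl <;> norm_num
  induction n with
  | zero =>
    have hm' := measurableSet_of_filtration (measurableSet_follows ε y l 0)
    rw [← setIntegral_indicator hm', ← integral_mul_const]
    refine setIntegral_step hΛ (fun ω ω' h => ?_) (hf.comp (· * _)) ?_
    · have h1 := det_follows ε y l 0 ω ω' h
      simp only at h1
      have h2 := hf.mono (Nat.le_succ l) ω ω' h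
      have h3 := h (l + 1 + 0) (by omega)
      simp only [Set.indicator, h1, h2, h3]
    · intro ω ω₁ ω₂ hω _ h1 h2 e1 e2
      rw [h0 ω hω] at e1 e2
      have key : ∀ ω', (∀ i ≤ l, X i ω' = X i ω) → ∀ z : ℤ, X (l + 1) ω' = z →
          (follows ε y l 0).indicator (fun ω => f ω * |(X (l + 1 + 0) ω : ℝ)|) ω' =
            if ε * z = y 0 ∧ 1 ≤ y 0 then f ω * |(z : ℝ)| else 0 := by
        intro ω' h z hz
        simp only [Set.indicator, follows, Nat.le_zero, forall_eq, Set.mem_ofPred_eq, add_zero, hz,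
          hf ω' ω h]
      rw [key ω₁ h1 _ e1, key ω₂ h2 _ e2]
      simp only [Finset.range_zero, Finset.prod_empty]
      rcases hε with rfl | rfl
      · by_cases hy : y 0 = 1
        · simp [hy]; ring
        · rw [if_neg (by omega), if_neg (by omega), if_neg hy]; simp
      · by_cases hy : y 0 = 1
        · simp [hy]; ring
        · rw [if_neg (by omega), if_neg (by omega), if_neg hy]; simp
  | succ n ih =>
    have hm : MeasurableSet[ℱ (l + 1 + n)] (Λ ∩ follows ε y l n) :=
      (ℱ.mono (by omega) _ hΛ).inter (measurableSet_follows ε y l n)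
    have hm' : MeasurableSet
        {ω : Traj | ε * X (l + 1 + n + 1) ω = y (n + 1) ∧ 1 ≤ y (n + 1)} :=
      measurableSet_of_filtration (measurableSet_X (le_refl (l + 1 + n + 1))
        {x | ε * x = y (n + 1) ∧ 1 ≤ y (n + 1)})
    rw [follows_succ, ← Set.inter_assoc, ← setIntegral_indicator hm']
    have hstep : ∫ ω in Λ ∩ follows ε y l n,
        {ω : Traj | ε * X (l + 1 + n + 1) ω = y (n + 1) ∧ 1 ≤ y (n + 1)}.indicator
          (fun ω => f ω * |(X (l + 1 + (n + 1)) ω : ℝ)|) ω ∂P =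
        ∫ ω in Λ ∩ follows ε y l n,
          f ω * |(X (l + 1 + n) ω : ℝ)| * besselStar (y n) (y (n + 1)) ∂P := by
      refine setIntegral_step hm (fun ω ω' h => ?_)
        ((hf.mono (show l ≤ l + 1 + n by omega)).comp₂ (det_X (le_refl (l + 1 + n)))
          fun a x => a * |(x : ℝ)| * besselStar (y n) (y (n + 1))) ?_
      · have h2 := hf.mono (show l ≤ l + 1 + n + 1 by omega) ω ω' h
        have h3 : X (l + 1 + n + 1) ω = X (l + 1 + n + 1) ω' := h _ le_rfl
        have h4 : X (l + 1 + (n + 1)) ω = X (l + 1 + (n + 1)) ω' := h3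
        simp only [Set.indicator, Set.mem_ofPred_eq, h2, h3, h4]
      · intro ω ω₁ ω₂ hω _ h1 h2 e1 e2
        obtain ⟨hy1, hy2⟩ := hω.2 n le_rfl
        have hX : X (l + 1 + n) ω = ε * y n := by rw [← hy1, ← mul_assoc, hεε, one_mul]
        have key : ∀ ω', (∀ i ≤ l + 1 + n, X i ω' = X i ω) → ∀ z : ℤ, X (l + 1 + n + 1) ω' = z →
            {ω : Traj | ε * X (l + 1 + n + 1) ω = y (n + 1) ∧ 1 ≤ y (n + 1)}.indicator
              (fun ω => f ω * |(X (l + 1 + (n + 1)) ω : ℝ)|) ω' =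
            if ε * z = y (n + 1) ∧ 1 ≤ y (n + 1) then f ω * |(z : ℝ)| else 0 := by
          intro ω' h z hz
          have hz' : X (l + 1 + (n + 1)) ω' = z := hz
          simp only [Set.indicator, Set.mem_ofPred_eq, hz, hz',
            hf.mono (show l ≤ l + 1 + n by omega) ω' ω h]
        rw [key ω₁ h1 _ e1, key ω₂ h2 _ e2, hX]
        have hyn : (0 : ℝ) < y n := by exact_mod_cast hy2
        have habs : |((ε * y n : ℤ) : ℝ)| = y n := by
          rcases hε with rfl | rfl <;> simp [abs_of_pos hyn]
        have hval : ∀ z : ℤ, ε * z = y (n + 1) → 1 ≤ y (n + 1) → |(z : ℝ)| = y (n + 1) := by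
          intro z hz h1
          have h1' : (0 : ℝ) < y (n + 1) := by exact_mod_cast h1
          have : z = ε * y (n + 1) := by rw [← hz, ← mul_assoc, hεε, one_mul]
          rw [this]
          rcases hε with rfl | rfl <;> simp [abs_of_pos h1']
        rw [habs]
        have hsum : (if ε * (ε * y n + 1) = y (n + 1) ∧ 1 ≤ y (n + 1) then
              f ω * |((ε * y n + 1 : ℤ) : ℝ)| else 0) +
            (if ε * (ε * y n - 1) = y (n + 1) ∧ 1 ≤ y (n + 1) then
              f ω * |((ε * y n - 1 : ℤ) : ℝ)| else 0) =
            if (y (n + 1) = y n + 1 ∨ y (n + 1) = y n - 1) then f ω * y (n + 1) else 0 := by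
          have e3 : ε * (ε * y n + 1) = y n + ε := by rw [mul_add, ← mul_assoc, hεε]; ring
          have e4 : ε * (ε * y n - 1) = y n - ε := by rw [mul_sub, ← mul_assoc, hεε]; ring
          by_cases hy0 : y (n + 1) = 0
          · simp [hy0]
          · split_ifs with c1 c2 c3 c3 c4 c5 c5
            · exfalso; rw [e3] at c1; rw [e4] at c2; rcases hε with rfl | rfl <;> omega
            · exfalso; rw [e3] at c1; rw [e4] at c2; rcases hε with rfl | rfl <;> omega
            · rw [hval _ c1.1 c1.2, add_zero]
            · exfalso; rw [e3] at c1; rcases hε with rfl | rfl <;> omega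
            · rw [hval _ c4.1 c4.2, zero_add]
            · exfalso; rw [e4] at c4; rcases hε with rfl | rfl <;> omega
            · exfalso; rw [e3] at c1; rw [e4] at c4; rcases hε with rfl | rfl <;> omega
            · simp
        rw [hsum, besselStar]
        have hyn' := hyn.ne'
        by_cases c1 : y (n + 1) = y n + 1
        · rw [if_pos (Or.inl c1), if_pos ⟨hy2, c1⟩, c1]
          push_cast
          field_simp
        · by_cases c2 : y (n + 1) = y n - 1
          · rw [if_pos (Or.inr c2), if_neg (by omega), if_pos ⟨hy2, c2⟩, c2]
            push_cast
            field_simp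
          · rw [if_neg (by omega), if_neg (by omega), if_neg (by omega)]
            ring
    rw [hstep, integral_mul_const, ih]
    split_ifs
    · rw [Finset.prod_range_succ]; ring
    · ring

end

/-! ### The number of zeros and the maximum of the simple random walk -/

theorem measurableSet_S_le (n : ℕ) (K : ℤ) : MeasurableSet[ℱ n] {ω | S n ω ≤ K} :=
  ((det_S le_rfl).comp (· ≤ K)).measurableSet

theorem P_real_S_le_aux (K : ℤ) (m N : ℕ) :
    P.real {ω | S (m + N) ω ≤ K} = ∫ ω in {ω | S N ω ≤ K}, meanSign m (K + 1 - X N ω) ∂P := by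
  induction m generalizing N with
  | zero =>
    rw [setIntegral_congr_fun (g := fun _ => 1)
      (measurableSet_of_filtration (measurableSet_S_le N K)), setIntegral_const, smul_eq_mul,
      mul_one, zero_add]
    intro ω hω
    have h1 := X_le_S N ω
    have h2 : S N ω ≤ K := hω
    simp only [meanSign]
    rw [Int.sign_eq_one_of_pos (by omega), Int.cast_one]
  | succ m ih =>
    have hset : {ω | S (N + 1) ω ≤ K} = {ω | S N ω ≤ K} ∩ {ω | X (N + 1) ω ≤ K} := by
      ext ω
      simp only [S_succ, Set.mem_ofPred_eq, Set.mem_inter_iff, max_le_iff]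
    rw [show m + 1 + N = m + (N + 1) by ring, ih, hset, setIntegral_inter_of_eq_zero
      (measurableSet_of_filtration (measurableSet_S_le N K))]
    · refine setIntegral_step (measurableSet_S_le N K)
        ((det_X le_rfl).comp fun x => meanSign m (K + 1 - x))
        ((det_X le_rfl).comp fun x => meanSign (m + 1) (K + 1 - x)) ?_
      intro ω ω₁ ω₂ _ _ _ _ e1 e2
      simp only [e1, e2]
      rw [meanSign_succ, show K + 1 - (X N ω + 1) = K + 1 - X N ω - 1 by ring,
        show K + 1 - (X N ω - 1) = K + 1 - X N ω + 1 by ring]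
      ring
    · intro ω h1 h2
      have h3 : S N ω ≤ K := h1
      have h4 : ¬ X (N + 1) ω ≤ K := h2
      have h5 := X_le_S N ω
      have : K + 1 - X (N + 1) ω = 0 := by
        rcases X_succ_cases N ω with h | h <;> omega
      rw [this, meanSign_zero_right]

theorem tendsto_P_real_S_le (K : ℕ) :
    Tendsto (fun n => P.real {ω | S n ω ≤ K}) atTop (𝓝 0) := by
  refine (tendsto_meanSign (K + 1)).congr fun n => ?_
  have h := P_real_S_le_aux K n 0
  have hX : ∀ᵐ ω ∂P, S 0 ω ≤ (K : ℤ) := ae_X_zero.mono fun ω hω => by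
    rw [S_zero, hω]; positivity
  rw [add_zero, setIntegral_congr_set (t := Set.univ) (eventuallyEq_univ.2 hX),
    Measure.restrict_univ, integral_congr_ae (g := fun _ => meanSign n (K + 1))
      (ae_X_zero.mono fun ω hω => by simp [hω])] at h
  rw [h]; simp

/-- The probability that an excursion stays at or below `k`. -/
noncomputable def stayProb (k : ℕ) : ℝ := 1 - 1 / (2 * ((k : ℝ) + 1))

theorem stayProb_pos (k : ℕ) : 0 < stayProb k := by
  have : 1 / (2 * ((k : ℝ) + 1)) ≤ 1 / 2 := by
    apply one_div_le_one_div_of_le two_pos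
    have : (0 : ℝ) ≤ k := k.cast_nonneg
    linarith
  unfold stayProb
  linarith

theorem stayProb_lt_one (k : ℕ) : stayProb k < 1 := by
  have : 0 < 1 / (2 * ((k : ℝ) + 1)) := by positivity
  unfold stayProb
  linarith

/-- The probability, for a walk at `x` after `c` zeros, to reach the zero number `a` before
exceeding `k`. -/
noncomputable def zeroProb (k a : ℕ) (x : ℤ) (c : ℕ) : ℝ :=
  if x = 0 then stayProb k ^ (a - c)
  else stayProb k ^ (a - c - 1) * (1 - max (x : ℝ) 0 / (k + 1))

theorem zeroProb_of_lt {k a c : ℕ} (x : ℤ) :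
    zeroProb k a x (c + if x = 0 then 1 else 0) =
      stayProb k ^ (a - c - 1) * (1 - max (x : ℝ) 0 / (k + 1)) := by
  unfold zeroProb
  split_ifs with h
  · simp [h, Nat.sub_sub]
  · simp

theorem zeroProb_step {k a c : ℕ} (hc : c < a) (x : ℤ) :
    zeroProb k a (x + 1) (c + if x + 1 = 0 then 1 else 0) +
      zeroProb k a (x - 1) (c + if x - 1 = 0 then 1 else 0) = 2 * zeroProb k a x c := by
  rw [zeroProb_of_lt, zeroProb_of_lt, zeroProb]
  have hk : (0 : ℝ) < k + 1 := by positivity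
  split_ifs with h
  · subst h
    rw [show a - c = a - c - 1 + 1 by omega, pow_succ, Nat.add_sub_cancel]
    simp only [stayProb]
    norm_num
    field_simp
    ring
  · rcases lt_or_gt_of_ne h with h | h
    · have h1 : ((x + 1 : ℤ) : ℝ) ≤ 0 := by exact_mod_cast h
      have h2 : ((x - 1 : ℤ) : ℝ) ≤ 0 := by exact_mod_cast (by omega : x - 1 ≤ 0)
      have h3 : (x : ℝ) ≤ 0 := by exact_mod_cast h.le
      rw [max_eq_right h1, max_eq_right h2, max_eq_right h3]
      ring
    · have h1 : (0 : ℝ) ≤ ((x + 1 : ℤ) : ℝ) := by exact_mod_cast (by omega : 0 ≤ x + 1)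
      have h2 : (0 : ℝ) ≤ ((x - 1 : ℤ) : ℝ) := by exact_mod_cast (by omega : 0 ≤ x - 1)
      have h3 : (0 : ℝ) ≤ (x : ℝ) := by exact_mod_cast h.le
      rw [max_eq_left h1, max_eq_left h2, max_eq_left h3]
      push_cast
      ring

theorem zeroProb_mem_Icc {k a c : ℕ} {x : ℤ} (hx : x ≤ k) : zeroProb k a x c ∈ Set.Icc 0 1 := by
  have hk : (0 : ℝ) < k + 1 := by positivity
  have h0 := (stayProb_pos k).le
  have h1 := (stayProb_lt_one k).le
  unfold zeroProb
  split_ifs with h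
  · exact ⟨pow_nonneg h0 _, pow_le_one₀ h0 h1⟩
  · have h2 : max (x : ℝ) 0 / (k + 1) ≤ 1 := by
      rw [div_le_one hk]
      refine max_le ?_ hk.le
      have : (x : ℝ) ≤ k := by exact_mod_cast hx
      linarith
    have h3 : 0 ≤ max (x : ℝ) 0 / (k + 1) := by positivity
    exact ⟨mul_nonneg (pow_nonneg h0 _) (by linarith),
      mul_le_one₀ (pow_le_one₀ h0 h1) (by linarith) (by linarith)⟩

/-- The path has its `a`-th zero at time `l`. -/
def zeroAt (a l : ℕ) : Set Traj := {ω | X l ω = 0 ∧ γ l ω = a}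

theorem measurableSet_zeroAt (a l : ℕ) : MeasurableSet[ℱ l] (zeroAt a l) :=
  ((det_X le_rfl).comp₂ (det_γ le_rfl) fun x c => x = 0 ∧ c = a).measurableSet

theorem measurableSet_γ_lt_S_le (a n k : ℕ) : MeasurableSet[ℱ n] {ω | γ n ω < a ∧ S n ω ≤ k} :=
  ((det_γ le_rfl).comp₂ (det_S le_rfl) fun c s => c < a ∧ s ≤ k).measurableSet

theorem det_zeroProb (k a n : ℕ) : Det n fun ω => zeroProb k a (X n ω) (γ n ω) :=
  (det_X le_rfl).comp₂ (det_γ le_rfl) (zeroProb k a)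

theorem integral_zeroProb_succ (k a n : ℕ) :
    P.real (zeroAt a (n + 1) ∩ {ω | S (n + 1) ω ≤ k}) +
      ∫ ω in {ω | γ (n + 1) ω < a ∧ S (n + 1) ω ≤ k},
        zeroProb k a (X (n + 1) ω) (γ (n + 1) ω) ∂P =
      ∫ ω in {ω | γ n ω < a ∧ S n ω ≤ k}, zeroProb k a (X n ω) (γ n ω) ∂P := by
  set A : Set Traj := {ω | γ n ω < a ∧ S n ω ≤ k} with hA_def
  have hA := measurableSet_γ_lt_S_le a n k
  have hA' := measurableSet_of_filtration hA
  have hB : MeasurableSet {ω | γ (n + 1) ω < a} :=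
    measurableSet_of_filtration (((det_γ (le_refl (n + 1))).comp (· < a)).measurableSet)
  have hstep : ∫ ω in A, zeroProb k a (X (n + 1) ω) (γ (n + 1) ω) ∂P =
      ∫ ω in A, zeroProb k a (X n ω) (γ n ω) ∂P := by
    refine setIntegral_step hA (det_zeroProb k a (n + 1)) (det_zeroProb k a n) ?_
    intro ω ω₁ ω₂ hω _ h1 h2 e1 e2
    rw [γ_succ, γ_succ, det_γ le_rfl ω₁ ω h1, det_γ le_rfl ω₂ ω h2, e1, e2]
    exact zeroProb_step hω.1 _
  have hsplit := integral_inter_add_sdiff (s := A) hB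
    (det_zeroProb k a (n + 1)).integrable.integrableOn
  rw [← hstep, ← hsplit, add_comm]
  congr 1
  · have hset : {ω | γ (n + 1) ω < a ∧ S (n + 1) ω ≤ k} =
        A ∩ {ω | γ (n + 1) ω < a} ∩ {ω | X (n + 1) ω ≤ k} := by
      ext ω
      have : γ n ω ≤ γ (n + 1) ω := γ_mono ω (Nat.le_succ n)
      simp only [S_succ, Set.mem_ofPred_eq, Set.mem_inter_iff, max_le_iff, hA_def] at this ⊢
      constructor
      · rintro ⟨h1, h2, h3⟩
        exact ⟨⟨⟨by omega, h2⟩, h1⟩, h3⟩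
      · rintro ⟨⟨⟨-, h2⟩, h1⟩, h3⟩
        exact ⟨h1, h2, h3⟩
    rw [hset, setIntegral_inter_of_eq_zero (hA'.inter hB)]
    rintro ω ⟨⟨-, h1⟩, -⟩ h2
    have h3 : ¬ X (n + 1) ω ≤ k := h2
    have h5 := X_le_S n ω
    have h4 : X (n + 1) ω = k + 1 := by
      rcases X_succ_cases n ω with h | h <;> omega
    have hk : (0 : ℝ) < k + 1 := by positivity
    rw [zeroProb, if_neg (by omega), h4]
    push_cast
    rw [max_eq_left hk.le, div_self hk.ne']
    ring
  · have hset : zeroAt a (n + 1) ∩ {ω | S (n + 1) ω ≤ k} = A \ {ω | γ (n + 1) ω < a} := by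
      ext ω
      have h1 := γ_succ n ω
      simp only [zeroAt, S_succ, Set.mem_ofPred_eq, Set.mem_inter_iff, max_le_iff, hA_def,
        Set.mem_sdiff, not_lt]
      constructor
      · rintro ⟨⟨h2, h3⟩, h4, h5⟩
        rw [if_pos h2] at h1
        exact ⟨⟨by omega, h4⟩, by omega⟩
      · rintro ⟨⟨h2, h4⟩, h5⟩
        split_ifs at h1 with h
        · exact ⟨⟨h, by omega⟩, h4, by omega⟩
        · omega
    rw [← hset, setIntegral_congr_fun (g := fun _ => 1), setIntegral_const, smul_eq_mul, mul_one]
    · rw [hset]; exact hA'.diff hB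
    · rintro ω ⟨⟨h1, h2⟩, -⟩
      simp [zeroProb, h1, h2]

theorem sum_zeroAt_add (k : ℕ) {a : ℕ} (ha : 1 ≤ a) (n : ℕ) :
    ∑ l ∈ Finset.range (n + 1), P.real (zeroAt a l ∩ {ω | S l ω ≤ k}) +
      ∫ ω in {ω | γ n ω < a ∧ S n ω ≤ k}, zeroProb k a (X n ω) (γ n ω) ∂P =
      stayProb k ^ (a - 1) := by
  induction n with
  | zero =>
    rw [Finset.sum_range_one]
    rcases eq_or_lt_of_le ha with rfl | ha
    · have h1 : (zeroAt 1 0 ∩ {ω | S 0 ω ≤ k} : Set Traj) =ᵐ[P] Set.univ :=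
        eventuallyEq_univ.2 (ae_X_zero.mono fun ω hω =>
          ⟨⟨hω, γ_zero hω⟩, by simp [S_zero, hω]⟩)
      have h2 : ({ω | γ 0 ω < 1 ∧ S 0 ω ≤ k} : Set Traj) =ᵐ[P] (∅ : Set Traj) :=
        eventuallyEq_empty.2 (ae_X_zero.mono fun ω hω h => by
          have : γ 0 ω < 1 := h.1
          rw [γ_zero hω] at this; omega)
      rw [measureReal_congr h1, setIntegral_congr_set h2]
      simp
    · have h1 : (zeroAt a 0 ∩ {ω | S 0 ω ≤ k} : Set Traj) =ᵐ[P] (∅ : Set Traj) :=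
        eventuallyEq_empty.2 (ae_X_zero.mono fun ω hω h => by
          have : γ 0 ω = a := h.1.2
          rw [γ_zero hω] at this; omega)
      have h2 : ({ω | γ 0 ω < a ∧ S 0 ω ≤ k} : Set Traj) =ᵐ[P] Set.univ :=
        eventuallyEq_univ.2 (ae_X_zero.mono fun ω hω =>
          ⟨by rw [γ_zero hω]; exact ha, by simp [S_zero, hω]⟩)
      rw [measureReal_congr h1, setIntegral_congr_set h2, Measure.restrict_univ,
        integral_congr_ae (g := fun _ => stayProb k ^ (a - 1))
          (ae_X_zero.mono fun ω hω => by simp [zeroProb, hω, γ_zero hω])]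
      simp
  | succ n ih =>
    rw [Finset.sum_range_succ, add_assoc, integral_zeroProb_succ, ih]

theorem hasSum_zeroAt_S_le (k : ℕ) {a : ℕ} (ha : 1 ≤ a) :
    HasSum (fun l => P.real (zeroAt a l ∩ {ω | S l ω ≤ k})) (stayProb k ^ (a - 1)) := by
  rw [hasSum_iff_tendsto_nat_of_nonneg fun _ => measureReal_nonneg, ← tendsto_add_atTop_iff_nat 1]
  have hrest : Tendsto (fun n => ∫ ω in {ω | γ n ω < a ∧ S n ω ≤ k},
      zeroProb k a (X n ω) (γ n ω) ∂P) atTop (𝓝 0) := by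
    refine squeeze_zero_norm (fun n => ?_) (tendsto_P_real_S_le k)
    have hm := measurableSet_of_filtration (measurableSet_γ_lt_S_le a n k)
    refine (norm_setIntegral_le_of_norm_le_const (C := 1) (measure_lt_top _ _)
      fun ω hω => ?_).trans ?_
    · have h := zeroProb_mem_Icc (k := k) (a := a) (c := γ n ω) ((X_le_S n ω).trans hω.2)
      rw [Real.norm_of_nonneg h.1]
      exact h.2
    · rw [one_mul]
      exact measureReal_mono fun ω hω => hω.2
  have h := (tendsto_const_nhds (x := stayProb k ^ (a - 1))).sub hrest
  rw [sub_zero] at h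
  exact h.congr fun n => by rw [← sum_zeroAt_add k ha n]; ring

theorem _root_.HasSum.of_eq {f f' : ℕ → ℝ} {s : ℝ} (h : HasSum f s) (heq : ∀ l, f l = f' l) :
    HasSum f' s := (funext heq : f = f') ▸ h

/-- The probability that the maximum at the `a`-th zero is `k`. -/
noncomputable def maxProb (a k : ℕ) : ℝ :=
  if k = 0 then (1 / 2) ^ (a - 1)
  else (1 - 1 / (2 * ((k : ℝ) + 1))) ^ (a - 1) - (1 - 1 / (2 * (k : ℝ))) ^ (a - 1)

theorem hasSum_zeroAt_S_eq {a : ℕ} (ha : 1 ≤ a) (k : ℕ) :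
    HasSum (fun l => P.real (zeroAt a l ∩ {ω | S l ω = k})) (maxProb a k) := by
  rcases k with _ | k
  · have h := hasSum_zeroAt_S_le 0 ha
    have h1 : stayProb 0 = 1 / 2 := by norm_num [stayProb]
    rw [h1] at h
    rw [maxProb, if_pos rfl]
    refine h.of_eq fun l => ?_
    refine measureReal_congr (ae_X_zero.mono fun ω hω => ?_)
    have := S_nonneg hω l
    refine propext (and_congr_right fun _ => ?_)
    change S l ω ≤ _ ↔ S l ω = _
    push_cast
    omega
  · have h := (hasSum_zeroAt_S_le (k + 1) ha).sub (hasSum_zeroAt_S_le k ha)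
    have h1 : stayProb (k + 1) ^ (a - 1) - stayProb k ^ (a - 1) = maxProb a (k + 1) := by
      rw [maxProb, if_neg (by omega), stayProb, stayProb]
      push_cast
      rfl
    rw [h1] at h
    refine h.of_eq fun l => ?_
    have hm : MeasurableSet (zeroAt a l ∩ {ω | S l ω ≤ k}) :=
      measurableSet_of_filtration ((measurableSet_zeroAt a l).inter (measurableSet_S_le l k))
    rw [← measureReal_sdiff _ hm]
    · congr 1
      ext ω
      simp only [Set.mem_inter_iff, Set.mem_ofPred_eq, Set.mem_sdiff, not_and]
      push_cast
      constructor
      · rintro ⟨⟨h1, h2⟩, h3⟩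
        have := h3 h1
        exact ⟨h1, by omega⟩
      · rintro ⟨h1, h2⟩
        exact ⟨⟨h1, h2.le⟩, fun _ => by omega⟩
    · rintro ω ⟨h1, h2⟩
      refine ⟨h1, ?_⟩
      have : S l ω ≤ k := h2
      change S l ω ≤ _
      push_cast
      omega

theorem half_mul_maxProb {a : ℕ} (ha : 1 ≤ a) (φ : ℕ → ℝ) (k : ℕ) :
    1 / 2 * maxProb a k * φ k = jointDensity φ a k := by
  unfold maxProb jointDensity
  split_ifs with h
  · subst h
    obtain ⟨b, rfl⟩ : ∃ b, a = b + 1 := ⟨a - 1, by omega⟩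
    rw [Nat.add_sub_cancel, pow_succ]
    ring
  · rfl

theorem hasSum_jointDensity (φ : ℕ → ℝ) (k : ℕ) :
    HasSum (fun a => jointDensity φ (a + 1) k) (φ k) := by
  have hgeom : ∀ j : ℕ, HasSum (fun a => stayProb j ^ a) (2 * (j + 1)) := by
    intro j
    have h := hasSum_geometric_of_lt_one (stayProb_pos j).le (stayProb_lt_one j)
    convert h using 1
    rw [stayProb, sub_sub_cancel, one_div, inv_inv]
  have hmax : HasSum (fun a => maxProb (a + 1) k) 2 := by
    rcases k with _ | k
    · have h := hgeom 0
      have h1 : stayProb 0 = 1 / 2 := by norm_num [stayProb]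
      rw [h1] at h
      simpa [maxProb] using h
    · have h := (hgeom (k + 1)).sub (hgeom k)
      have h2 : 2 * (((k + 1 : ℕ) : ℝ) + 1) - 2 * ((k : ℝ) + 1) = 2 := by push_cast; ring
      rw [h2] at h
      refine h.of_eq fun a => ?_
      rw [maxProb, if_neg (by omega), stayProb, stayProb]
      push_cast
      rfl
  have h := (hmax.mul_left (1 / 2)).mul_right (φ k)
  simp only [half_mul_maxProb (Nat.le_add_left 1 _)] at h
  rwa [show (1 / 2 : ℝ) * 2 * φ k = φ k by ring] at h

/-! ### The last zero and the zero number `a` -/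

/-- The time `l` is the last zero. -/
def lastAt (l : ℕ) : Set Traj := {ω | X l ω = 0} ∩ noZeroAfter l

theorem lastZero_of_lastAt {l : ℕ} {ω : Traj} (h : ω ∈ lastAt l) : lastZero ω = l := by
  refine le_antisymm (iSup₂_le fun k hk => ?_) (le_iSup₂_of_le l h.1 le_rfl)
  by_contra hlt
  exact h.2 k (by exact_mod_cast not_le.1 hlt) hk

theorem g_of_lastAt {l : ℕ} {ω : Traj} (h : ω ∈ lastAt l) : g ω = l := by
  rw [g, lastZero_of_lastAt h, ENat.toNat_natCast]

theorem pairwise_disjoint_lastAt : Pairwise (Function.onFun Disjoint lastAt) :=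
  fun _ _ hne => Set.disjoint_left.2 fun _ h1 h2 =>
    hne ((g_of_lastAt h1).symm.trans (g_of_lastAt h2))

theorem measurableSet_lastAt (l : ℕ) : MeasurableSet (lastAt l) :=
  (measurableSet_of_filtration (measurableSet_X (le_refl l) {x | x = 0})).inter
    (measurableSet_noZeroAfter l)

theorem measurable_enat_of_le {f : Traj → ℕ∞} (hle : ∀ l : ℕ, MeasurableSet {ω | f ω ≤ l}) :
    Measurable f := by
  rw [ENat.measurable_iff]
  intro l
  have : f ⁻¹' {(l : ℕ∞)} = {ω | f ω ≤ l} ∩ ⋂ j : Fin l, {ω | f ω ≤ (j : ℕ)}ᶜ := by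
    ext ω
    simp only [Set.mem_preimage, Set.mem_singleton_iff, Set.mem_inter_iff, Set.mem_ofPred_eq,
      Set.mem_iInter, Set.mem_compl_iff, not_le]
    constructor
    · intro h
      rw [h]
      exact ⟨le_rfl, fun j => by exact_mod_cast j.2⟩
    · rintro ⟨h1, h2⟩
      obtain ⟨n, hn⟩ := ENat.ne_top_iff_exists.1 (ne_top_of_le_ne_top (ENat.natCast_ne_top l) h1)
      rw [← hn] at h1 h2 ⊢
      rcases eq_or_lt_of_le h1 with h | h
      · exact h
      · exact absurd (h2 ⟨n, by exact_mod_cast h⟩) (lt_irrefl _)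
  rw [this]
  exact (hle l).inter (MeasurableSet.iInter fun j => (hle j).compl)

theorem measurable_lastZero : Measurable lastZero := by
  refine measurable_enat_of_le fun l => ?_
  have : {ω | lastZero ω ≤ l} = ⋂ k : ℕ, {ω | X k ω ∈ {x : ℤ | x = 0 → k ≤ l}} := by
    ext ω
    simp [lastZero, iSup_le_iff]
  rw [this]
  exact MeasurableSet.iInter fun k => measurableSet_of_filtration (measurableSet_X (le_refl k) _)

theorem measurable_g : Measurable g := (measurable_of_countable ENat.toNat).comp measurable_lastZero

theorem γ_pos_of_zero {l : ℕ} {ω : Traj} (h : X l ω = 0) : 0 < γ l ω :=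
  Finset.card_pos.2 ⟨l, by simp [h]⟩

theorem γ_lt_of_zero {l m : ℕ} {ω : Traj} (h : X l ω = 0) (hm : m < l) : γ m ω < γ l ω := by
  obtain ⟨l, rfl⟩ : ∃ j, l = j + 1 := ⟨l - 1, by omega⟩
  have h1 : γ m ω ≤ γ l ω := γ_mono ω (by omega)
  rw [γ_succ, if_pos h]
  omega

theorem hitCount_of_zeroAt {a l : ℕ} {ω : Traj} (h : ω ∈ zeroAt a l) : hitCount a ω = l := by
  refine le_antisymm (iInf₂_le_of_le l h.2 le_rfl) (le_iInf₂ fun m hm => ?_)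
  by_contra hlt
  have h1 := γ_lt_of_zero h.1 (by exact_mod_cast not_le.1 hlt)
  rw [hm, h.2] at h1
  omega

theorem τ_of_zeroAt {a l : ℕ} {ω : Traj} (h : ω ∈ zeroAt a l) : τ a ω = l := by
  rw [τ, hitCount_of_zeroAt h, ENat.toNat_natCast]

theorem pairwise_disjoint_zeroAt (a : ℕ) : Pairwise (Function.onFun Disjoint (zeroAt a)) :=
  fun _ _ hne => Set.disjoint_left.2 fun _ h1 h2 =>
    hne ((τ_of_zeroAt h1).symm.trans (τ_of_zeroAt h2))

theorem measurable_τ (a : ℕ) : Measurable (τ a) := by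
  have hle : ∀ l : ℕ, MeasurableSet {ω | (l : ℕ∞) ≤ hitCount a ω} := by
    intro l
    have : {ω | (l : ℕ∞) ≤ hitCount a ω} = ⋂ k : ℕ, {ω | γ k ω = a → l ≤ k} := by
      ext ω
      simp [hitCount, le_iInf_iff]
    rw [this]
    exact MeasurableSet.iInter fun k => measurableSet_of_filtration
      ((det_γ (le_refl k)).comp fun c => c = a → l ≤ k).measurableSet
  refine (measurable_of_countable ENat.toNat).comp ?_
  rw [ENat.measurable_iff]
  intro l
  have : hitCount a ⁻¹' {(l : ℕ∞)} = {ω | (l : ℕ∞) ≤ hitCount a ω} \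
      {ω | ((l + 1 : ℕ) : ℕ∞) ≤ hitCount a ω} := by
    ext ω
    simp only [Set.mem_preimage, Set.mem_singleton_iff, Set.mem_sdiff, Set.mem_ofPred_eq, not_le]
    constructor
    · intro h
      rw [h]
      exact ⟨le_rfl, by exact_mod_cast Nat.lt_succ_self l⟩
    · rintro ⟨h1, h2⟩
      obtain ⟨n, hn⟩ := ENat.ne_top_iff_exists.1 (ne_top_of_lt h2)
      rw [← hn] at h1 h2 ⊢
      have h3 : l ≤ n := by exact_mod_cast h1
      have h4 : n < l + 1 := by exact_mod_cast h2
      exact_mod_cast (by omega : n = l)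
  rw [this]
  exact (hle l).diff (hle (l + 1))

theorem measurableSet_at {T : Traj → ℕ} (hT : Measurable T) {p : ℕ → Traj → Prop}
    (hp : ∀ l, Det l (p l)) : MeasurableSet {ω | p (T ω) ω} := by
  have : {ω | p (T ω) ω} = ⋃ l, T ⁻¹' {l} ∩ {ω | p l ω} := by
    ext ω; simp
  rw [this]
  exact MeasurableSet.iUnion fun l => (hT (measurableSet_singleton l)).inter
    (measurableSet_of_filtration (hp l).measurableSet)

theorem measurable_X_at {T : Traj → ℕ} (hT : Measurable T) : Measurable fun ω => X (T ω) ω := by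
  have h : Measurable fun p : ℕ × Traj => X p.1 p.2 :=
    measurable_from_prod_countable_right fun n => measurable_X n
  exact h.comp (hT.prodMk measurable_id)

theorem measurable_pathUpTo {T : Traj → ℕ} (hT : Measurable T) : Measurable (pathUpTo T) :=
  hT.prodMk (measurable_pi_lambda _ fun n =>
    measurable_X_at ((measurable_of_countable (min n)).comp hT))

theorem measurable_postPath : Measurable postPath :=
  measurable_pi_lambda _ fun n =>
    measurable_X_at ((measurable_of_countable fun k => k + 1 + n).comp measurable_g)

/-- The path stopped at the fixed time `l` is determined by the path up to `l`. -/
theorem det_pathUpTo (l : ℕ) : Det l (pathUpTo fun _ => l) := fun ω ω' h => by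
  simp only [pathUpTo, Prod.mk.injEq, true_and]
  exact funext fun n => h _ (min_le_right _ _)

/-! ### The penalised measure seen from the last zero -/

section

variable {φ : ℕ → ℝ}

/-- The mass under the penalised measure of the paths in `Λ ∈ ℱ l` with last zero `l`. -/
noncomputable def zeroWeight (φ : ℕ → ℝ) (l : ℕ) (Λ : Set Traj) : ℝ≥0∞ :=
  ENNReal.ofReal (1 / 2 * ∫ ω in Λ ∩ {ω | X l ω = 0}, φ (S l ω).toNat ∂P)

/-- The product of the transition probabilities of the 3-Bessel* walk along `y 0, …, y n`. -/
noncomputable def besselProd (y : ℕ → ℤ) (n : ℕ) : ℝ :=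
  ∏ i ∈ Finset.range n, besselStar (y i) (y (i + 1))

theorem det_φ_S (φ : ℕ → ℝ) (l : ℕ) : Det l fun ω => φ (S l ω).toNat :=
  (det_S le_rfl).comp fun s => φ s.toNat

theorem inter_lastAt_eq_follows {ε : ℤ} (hε : ε = 1 ∨ ε = -1) {y : ℕ → ℤ} (hy : y 0 = 1) {l : ℕ}
    (Λ : Set Traj) (n : ℕ) :
    Λ ∩ lastAt l ∩ {ω | ∀ i ≤ n, ε * X (l + 1 + i) ω = y i} =
      (Λ ∩ {ω | X l ω = 0}) ∩ follows ε y l n ∩ noZeroAfter (l + 1 + n) := by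
  ext ω
  constructor
  · rintro ⟨⟨h1, h2, h3⟩, h4⟩
    refine ⟨⟨⟨h1, h2⟩, fun i hi => ⟨h4 i hi, ?_⟩⟩, fun i hi => h3 i (by omega)⟩
    induction i with
    | zero => omega
    | succ i ih =>
      have e1 := ih (by omega)
      have e2 := h4 i (by omega)
      have e3 : ε * X (l + 1 + i + 1) ω = y (i + 1) := h4 (i + 1) hi
      have e4 := h3 (l + 1 + i + 1) (by omega)
      rcases hε with rfl | rfl <;> rcases X_succ_cases (l + 1 + i) ω with h | h <;> omega
  · rintro ⟨⟨⟨h1, h2⟩, h3⟩, h4⟩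
    refine ⟨⟨h1, h2, fun i hi h0 => ?_⟩, fun i hi => (h3 i hi).1⟩
    rcases Nat.lt_or_ge (l + 1 + n) i with h | h
    · exact h4 i h h0
    · have e := h3 (i - (l + 1)) (by omega)
      rw [show l + 1 + (i - (l + 1)) = i by omega, h0] at e
      omega

theorem besselStar_nonneg (x y : ℤ) : 0 ≤ besselStar x y := by
  unfold besselStar
  split_ifs with h1 h2
  · have : (1 : ℝ) ≤ x := by exact_mod_cast h1.1
    positivity
  · have : (1 : ℝ) ≤ x := by exact_mod_cast h2.1
    exact div_nonneg (by linarith) (by linarith)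
  · exact le_rfl

theorem besselProd_nonneg (y : ℕ → ℤ) (n : ℕ) : 0 ≤ besselProd y n :=
  Finset.prod_nonneg fun _ _ => besselStar_nonneg _ _

variable {Q : Measure Traj}

theorem IsPenalised.apply_lastAt_follows (hQ : IsPenalised φ Q)
    (hφ : HasSum φ 1) (h0 : ∀ k, 0 ≤ φ k) (hmean : Summable fun k : ℕ => (k : ℝ) * φ k)
    {ε : ℤ} (hε : ε = 1 ∨ ε = -1) {y : ℕ → ℤ} (hy : y 0 = 1) {l : ℕ} {Λ : Set Traj}
    (hΛ : MeasurableSet[ℱ l] Λ) (n : ℕ) :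
    Q (Λ ∩ lastAt l ∩ {ω | ∀ i ≤ n, ε * X (l + 1 + i) ω = y i}) =
      zeroWeight φ l Λ * ENNReal.ofReal (1 / 2 * besselProd y n) := by
  have hΛ0 : MeasurableSet[ℱ l] (Λ ∩ {ω | X l ω = 0}) :=
    hΛ.inter (measurableSet_X le_rfl {x | x = 0})
  have hm : MeasurableSet[ℱ (l + 1 + n)] (Λ ∩ {ω | X l ω = 0} ∩ follows ε y l n) :=
    (ℱ.mono (by omega) _ hΛ0).inter (measurableSet_follows ε y l n)
  rw [inter_lastAt_eq_follows hε hy, hQ.apply_noZeroAfter hφ h0 hmean hm, zeroWeight,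
    ← ENNReal.ofReal_mul' (mul_nonneg (by norm_num) (besselProd_nonneg y n))]
  · congr 1
    have h := setIntegral_follows hε y hΛ0 (fun ω hω => hω.2) (det_φ_S φ l) n
    rw [if_pos hy] at h
    rw [mul_assoc, besselProd, ← h]
    congr 1
    refine setIntegral_congr_fun (measurableSet_of_filtration hm) fun ω hω => ?_
    simp only [Sg_of_follows hω.2, Sg_of_zero hω.1.2]
  · intro ω hω h
    have := hω.2 n le_rfl
    rw [h] at this
    omega

theorem IsPenalised.apply_lastAt (hQ : IsPenalised φ Q)
    (hφ : HasSum φ 1) (h0 : ∀ k, 0 ≤ φ k) (hmean : Summable fun k : ℕ => (k : ℝ) * φ k)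
    {l : ℕ} {Λ : Set Traj} (hΛ : MeasurableSet[ℱ l] Λ) :
    Q (Λ ∩ lastAt l) = zeroWeight φ l Λ := by
  have h1 := hQ.apply_lastAt_follows hφ h0 hmean (Or.inl rfl) (y := fun _ => 1) rfl hΛ 0
  have h2 := hQ.apply_lastAt_follows hφ h0 hmean (Or.inr rfl) (y := fun _ => 1) rfl hΛ 0
  have hset : ∀ ε : ℤ, {ω : Traj | ∀ i ≤ 0, ε * X (l + 1 + i) ω = 1} =
      {ω | ε * X (l + 1) ω = 1} := fun ε => by ext ω; simp
  rw [hset] at h1 h2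
  have hm : MeasurableSet {ω : Traj | 1 * X (l + 1) ω = 1} :=
    measurableSet_of_filtration (measurableSet_X (le_refl (l + 1)) {x | 1 * x = 1})
  rw [← measure_inter_add_sdiff (Λ ∩ lastAt l) hm, h1]
  have hd : (Λ ∩ lastAt l) \ {ω | 1 * X (l + 1) ω = 1} =
      Λ ∩ lastAt l ∩ {ω | -1 * X (l + 1) ω = 1} := by
    ext ω
    refine and_congr_right fun h => ?_
    have e1 : X l ω = 0 := h.2.1
    simp only [Set.mem_ofPred_eq]
    rcases X_succ_cases l ω with h | h <;> omega
  rw [hd, h2, ← mul_add, ← ENNReal.ofReal_add] <;> norm_num [besselProd]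

/-- The last zero is finite. -/
def finiteLast : Set Traj := ⋃ l, lastAt l

theorem measurableSet_finiteLast : MeasurableSet finiteLast :=
  MeasurableSet.iUnion measurableSet_lastAt

theorem X_g_of_finiteLast {ω : Traj} (h : ω ∈ finiteLast) : X (g ω) ω = 0 := by
  obtain ⟨l, hl⟩ := Set.mem_iUnion.1 h
  rw [g_of_lastAt hl]
  exact hl.1

theorem X_after_g {ω : Traj} (h : ω ∈ finiteLast) {i : ℕ} (hi : g ω < i) : X i ω ≠ 0 := by
  obtain ⟨l, hl⟩ := Set.mem_iUnion.1 h
  rw [g_of_lastAt hl] at hi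
  exact hl.2 i hi

theorem IsPenalised.apply_at_g (hQ : IsPenalised φ Q)
    (hφ : HasSum φ 1) (h0 : ∀ k, 0 ≤ φ k) (hmean : Summable fun k : ℕ => (k : ℝ) * φ k)
    {p : ℕ → Traj → Prop} (hp : ∀ l, Det l (p l)) :
    Q ({ω | p (g ω) ω} ∩ finiteLast) = ∑' l, zeroWeight φ l {ω | p l ω} := by
  have hset : {ω | p (g ω) ω} ∩ finiteLast = ⋃ l, {ω | p l ω} ∩ lastAt l := by
    rw [finiteLast, Set.inter_iUnion]
    refine Set.iUnion_congr fun l => Set.ext fun ω => and_congr_left fun h => ?_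
    simp only [Set.mem_ofPred_eq, g_of_lastAt h]
  rw [hset, measure_iUnion]
  · exact tsum_congr fun l => hQ.apply_lastAt hφ h0 hmean (hp l).measurableSet
  · exact fun i j hij => (pairwise_disjoint_lastAt hij).mono Set.inter_subset_right
      Set.inter_subset_right
  · exact fun l => (measurableSet_of_filtration (hp l).measurableSet).inter
      (measurableSet_lastAt l)

theorem IsPenalised.apply_at_g_postPath (hQ : IsPenalised φ Q)
    (hφ : HasSum φ 1) (h0 : ∀ k, 0 ≤ φ k) (hmean : Summable fun k : ℕ => (k : ℝ) * φ k)
    {p : ℕ → Traj → Prop} (hp : ∀ l, Det l (p l)) {ε : ℤ} (hε : ε = 1 ∨ ε = -1) {y : ℕ → ℤ}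
    (hy : y 0 = 1) (n : ℕ) :
    Q ({ω | p (g ω) ω} ∩ {ω | ∀ i ≤ n, ε * postPath ω i = y i} ∩ finiteLast) =
      Q ({ω | p (g ω) ω} ∩ finiteLast) * ENNReal.ofReal (1 / 2 * besselProd y n) := by
  have hset : {ω | p (g ω) ω} ∩ {ω | ∀ i ≤ n, ε * postPath ω i = y i} ∩ finiteLast =
      ⋃ l, {ω | p l ω} ∩ lastAt l ∩ {ω | ∀ i ≤ n, ε * X (l + 1 + i) ω = y i} := by
    rw [finiteLast, Set.inter_iUnion]
    refine Set.iUnion_congr fun l => ?_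
    rw [Set.inter_right_comm]
    ext ω
    simp only [Set.mem_inter_iff, Set.mem_ofPred_eq]
    constructor
    · rintro ⟨⟨h1, h2⟩, h3⟩
      rw [g_of_lastAt h2] at h1
      simp only [postPath, g_of_lastAt h2] at h3
      exact ⟨⟨h1, h2⟩, h3⟩
    · rintro ⟨⟨h1, h2⟩, h3⟩
      simp only [postPath, g_of_lastAt h2]
      exact ⟨⟨h1, h2⟩, h3⟩
  rw [hQ.apply_at_g hφ h0 hmean hp, hset, measure_iUnion, ← ENNReal.tsum_mul_right]
  · exact tsum_congr fun l => hQ.apply_lastAt_follows hφ h0 hmean hε hy (hp l).measurableSet n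
  · exact fun i j hij => (pairwise_disjoint_lastAt hij).mono
      (Set.inter_subset_left.trans Set.inter_subset_right)
      (Set.inter_subset_left.trans Set.inter_subset_right)
  · intro l
    refine ((measurableSet_of_filtration (hp l).measurableSet).inter
      (measurableSet_lastAt l)).inter ?_
    have : Det (l + 1 + n) fun ω => ∀ i ≤ n, ε * X (l + 1 + i) ω = y i := fun ω ω' h => by
      refine propext (forall₂_congr fun i hi => ?_)
      rw [h _ (by omega)]
    exact measurableSet_of_filtration this.measurableSet

theorem det_γ_S (a k : ℕ) {p : ℕ → Traj → Prop} (hp : ∀ l, Det l (p l)) (l : ℕ) :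
    Det l fun ω => (γ l ω = a ∧ S l ω = k) ∧ p l ω :=
  ((det_γ le_rfl).comp₂ (det_S le_rfl) fun c s => c = a ∧ s = k).comp₂ (hp l) And

theorem zeroWeight_γ_S (h0 : ∀ k, 0 ≤ φ k) (a k l : ℕ) (Λ : Set Traj)
    (hΛ : MeasurableSet[ℱ l] Λ) :
    zeroWeight φ l ({ω | γ l ω = a ∧ S l ω = k} ∩ Λ) =
      ENNReal.ofReal (1 / 2 * φ k) * P (zeroAt a l ∩ {ω | S l ω = k} ∩ Λ) := by
  have hset : {ω | γ l ω = a ∧ S l ω = k} ∩ Λ ∩ {ω | X l ω = 0} =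
      zeroAt a l ∩ {ω | S l ω = k} ∩ Λ := by
    ext ω; simp only [zeroAt, Set.mem_inter_iff, Set.mem_ofPred_eq]; tauto
  have hS : MeasurableSet[ℱ l] {ω : Traj | S l ω = k} :=
    ((det_S le_rfl).comp fun s => s = (k : ℤ)).measurableSet
  have hm := measurableSet_of_filtration (((measurableSet_zeroAt a l).inter hS).inter hΛ)
  rw [zeroWeight, hset, setIntegral_congr_fun (g := fun _ => φ k) hm, setIntegral_const,
    smul_eq_mul, mul_comm (P.real _), ← mul_assoc, ENNReal.ofReal_mul (by have := h0 k; positivity),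
    ofReal_measureReal]
  intro ω hω
  have : S l ω = k := hω.1.2
  simp [this]

theorem IsPenalised.apply_γ_S_at_g (hQ : IsPenalised φ Q)
    (hφ : HasSum φ 1) (h0 : ∀ k, 0 ≤ φ k) (hmean : Summable fun k : ℕ => (k : ℝ) * φ k)
    (a k : ℕ) {p : ℕ → Traj → Prop} (hp : ∀ l, Det l (p l)) :
    Q ({ω | (γ (g ω) ω = a ∧ S (g ω) ω = k) ∧ p (g ω) ω} ∩ finiteLast) =
      ENNReal.ofReal (1 / 2 * φ k) *
        ∑' l, P (zeroAt a l ∩ {ω | S l ω = k} ∩ {ω | p l ω}) := by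
  rw [hQ.apply_at_g hφ h0 hmean (det_γ_S a k hp), ← ENNReal.tsum_mul_left]
  exact tsum_congr fun l => zeroWeight_γ_S h0 a k l _ (hp l).measurableSet

theorem det_true (l : ℕ) : Det l fun _ : Traj => True := fun _ _ _ => rfl

theorem maxProb_nonneg {a : ℕ} (ha : 1 ≤ a) (k : ℕ) : 0 ≤ maxProb a k :=
  (hasSum_zeroAt_S_eq ha k).nonneg fun _ => measureReal_nonneg

theorem jointDensity_nonneg (h0 : ∀ k, 0 ≤ φ k) {a : ℕ} (ha : 1 ≤ a) (k : ℕ) :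
    0 ≤ jointDensity φ a k := by
  rw [← half_mul_maxProb ha]
  have := maxProb_nonneg ha k
  have := h0 k
  positivity

theorem IsPenalised.apply_γ_S (hQ : IsPenalised φ Q)
    (hφ : HasSum φ 1) (h0 : ∀ k, 0 ≤ φ k) (hmean : Summable fun k : ℕ => (k : ℝ) * φ k)
    {a : ℕ} (ha : 1 ≤ a) (k : ℕ) :
    Q ({ω | γ (g ω) ω = a ∧ S (g ω) ω = k} ∩ finiteLast) =
      ENNReal.ofReal (jointDensity φ a k) := by
  have h := hQ.apply_γ_S_at_g hφ h0 hmean a k det_true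
  simp only [and_true] at h
  have hP : ∀ l, P (zeroAt a l ∩ {ω | S l ω = k} ∩ {_ω | True}) =
      ENNReal.ofReal (P.real (zeroAt a l ∩ {ω | S l ω = k})) := fun l => by
    rw [ofReal_measureReal, show {_ω : Traj | True} = Set.univ from rfl, Set.inter_univ]
  have hs := hasSum_zeroAt_S_eq ha k
  rw [h, tsum_congr hP, ← ENNReal.ofReal_tsum_of_nonneg (fun _ => measureReal_nonneg) hs.summable,
    hs.tsum_eq, ← ENNReal.ofReal_mul (by have := h0 k; positivity), ← half_mul_maxProb ha]
  congr 1
  ring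

theorem measurableSet_γ_S_at_g (a k : ℕ) :
    MeasurableSet {ω | γ (g ω) ω = a ∧ S (g ω) ω = k} :=
  measurableSet_at measurable_g (p := fun l ω => γ l ω = a ∧ S l ω = k) fun _ =>
    (det_γ le_rfl).comp₂ (det_S le_rfl) fun c s => c = a ∧ s = (k : ℤ)

theorem measurableSet_S_at_g (k : ℕ) : MeasurableSet {ω | S (g ω) ω = k} :=
  measurableSet_at measurable_g (p := fun l ω => S l ω = k) fun _ =>
    (det_S le_rfl).comp fun s => s = (k : ℤ)

theorem IsPenalised.apply_S (hQ : IsPenalised φ Q)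
    (hφ : HasSum φ 1) (h0 : ∀ k, 0 ≤ φ k) (hmean : Summable fun k : ℕ => (k : ℝ) * φ k) (k : ℕ) :
    Q ({ω | S (g ω) ω = k} ∩ finiteLast) = ENNReal.ofReal (φ k) := by
  have hset : {ω | S (g ω) ω = k} ∩ finiteLast =
      ⋃ a : ℕ, {ω | γ (g ω) ω = a + 1 ∧ S (g ω) ω = k} ∩ finiteLast := by
    ext ω
    simp only [Set.mem_inter_iff, Set.mem_ofPred_eq, Set.mem_iUnion]
    constructor
    · rintro ⟨h1, h2⟩
      have := γ_pos_of_zero (X_g_of_finiteLast h2)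
      exact ⟨γ (g ω) ω - 1, ⟨by omega, h1⟩, h2⟩
    · rintro ⟨a, ⟨-, h1⟩, h2⟩
      exact ⟨h1, h2⟩
  have hs := hasSum_jointDensity φ k
  rw [hset, measure_iUnion, tsum_congr fun a => hQ.apply_γ_S hφ h0 hmean (Nat.le_add_left 1 a) k,
    ← ENNReal.ofReal_tsum_of_nonneg (fun a => jointDensity_nonneg h0 (Nat.le_add_left 1 a) k)
      hs.summable, hs.tsum_eq]
  · intro i j hij
    refine Set.disjoint_left.2 fun ω h1 h2 => hij ?_
    have e1 := h1.1.1
    have e2 := h2.1.1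
    omega
  · exact fun a => (measurableSet_γ_S_at_g (a + 1) k).inter measurableSet_finiteLast

theorem IsPenalised.ae_finiteLast (hQ : IsPenalised φ Q)
    (hφ : HasSum φ 1) (h0 : ∀ k, 0 ≤ φ k) (hmean : Summable fun k : ℕ => (k : ℝ) * φ k) :
    ∀ᵐ ω ∂Q, ω ∈ finiteLast := by
  have := hQ.isProbabilityMeasure
  change finiteLast ∈ ae Q
  rw [mem_ae_iff_prob_eq_one measurableSet_finiteLast]
  refine le_antisymm prob_le_one ?_
  have hm : ∀ k : ℕ, MeasurableSet ({ω | S (g ω) ω = k} ∩ finiteLast) := fun k =>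
    (measurableSet_S_at_g k).inter measurableSet_finiteLast
  have h1 : Q (⋃ k : ℕ, {ω | S (g ω) ω = k} ∩ finiteLast) = 1 := by
    rw [measure_iUnion _ hm, tsum_congr fun k => hQ.apply_S hφ h0 hmean k,
      ← ENNReal.ofReal_tsum_of_nonneg h0 hφ.summable, hφ.tsum_eq, ENNReal.ofReal_one]
    refine fun i j hij => Set.disjoint_left.2 fun ω h1 h2 => hij ?_
    have e1 : S (g ω) ω = i := h1.1
    have e2 : S (g ω) ω = j := h2.1
    omega
  rw [← h1]
  exact measure_mono (Set.iUnion_subset fun k => Set.inter_subset_right)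

theorem IsPenalised.inter_finiteLast (hQ : IsPenalised φ Q)
    (hφ : HasSum φ 1) (h0 : ∀ k, 0 ≤ φ k) (hmean : Summable fun k : ℕ => (k : ℝ) * φ k)
    (E : Set Traj) : Q (E ∩ finiteLast) = Q E :=
  measure_congr ((hQ.ae_finiteLast hφ h0 hmean).mono fun _ hω =>
    propext (and_iff_left hω))

end

/-! ### Independence and the law of the path after the last zero -/

theorem generateFrom_initial_segments :
    (MeasurableSpace.pi : MeasurableSpace (ℕ → ℤ)) =
      MeasurableSpace.generateFrom {B | ∃ (n : ℕ) (y : ℕ → ℤ), B = {f | ∀ i ≤ n, f i = y i}} := by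
  refine le_antisymm (iSup_le fun n => ?_) (MeasurableSpace.generateFrom_le ?_)
  · rw [← measurable_iff_comap_le]
    refine @measurable_to_countable' _ _ _ _ (_) _ fun z => ?_
    let e : (Fin (n + 1) → ℤ) → ℕ → ℤ := fun c i => if h : i < n + 1 then c ⟨i, h⟩ else 0
    have hset : (fun f : ℕ → ℤ => f n) ⁻¹' {z} =
        ⋃ c : {c : Fin (n + 1) → ℤ // c (Fin.last n) = z}, {f | ∀ i ≤ n, f i = e c i} := by
      ext f
      simp only [Set.mem_preimage, Set.mem_singleton_iff, Set.mem_iUnion, Set.mem_ofPred_eq]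
      constructor
      · intro h
        refine ⟨⟨fun i => f i, h⟩, fun i hi => ?_⟩
        simp only [e, dif_pos (Nat.lt_succ_of_le hi)]
      · rintro ⟨⟨c, rfl⟩, hc⟩
        rw [hc n le_rfl]
        simp [e, Fin.last]
    rw [hset]
    exact @MeasurableSet.iUnion _ _ (_) _ _ fun c =>
      MeasurableSpace.measurableSet_generateFrom ⟨n, e c, rfl⟩
  · rintro _ ⟨n, y, rfl⟩
    have : {f : ℕ → ℤ | ∀ i ≤ n, f i = y i} = ⋂ i : ℕ, ⋂ _ : i ≤ n, {f | f i = y i} := by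
      ext f; simp
    rw [this]
    refine MeasurableSet.iInter fun i => MeasurableSet.iInter fun _ => ?_
    have h : Measurable fun f : ℕ → ℤ => f i := measurable_pi_apply i
    exact h (measurableSet_singleton (y i))

theorem isPiSystem_initial_segments :
    IsPiSystem {B : Set (ℕ → ℤ) | ∃ (n : ℕ) (y : ℕ → ℤ), B = {f | ∀ i ≤ n, f i = y i}} := by
  rintro _ ⟨n, y, rfl⟩ _ ⟨m, z, rfl⟩ ⟨f, hf1, hf2⟩
  refine ⟨max n m, f, ?_⟩
  ext f'
  simp only [Set.mem_inter_iff, Set.mem_ofPred_eq] at hf1 hf2 ⊢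
  constructor
  · rintro ⟨h1, h2⟩ i hi
    rcases le_max_iff.1 hi with h | h
    · rw [h1 i h, hf1 i h]
    · rw [h2 i h, hf2 i h]
  · exact fun h => ⟨fun i hi => by rw [h i (le_max_of_le_left hi), hf1 i hi],
      fun i hi => by rw [h i (le_max_of_le_right hi), hf2 i hi]⟩

section

variable {φ : ℕ → ℝ} {Q : Measure Traj}

/-- The law of the path after the last zero, on the initial segments. -/
noncomputable def postProb (y : ℕ → ℤ) (n : ℕ) : ℝ≥0∞ :=
  if y 0 = 1 then ENNReal.ofReal (1 / 2 * besselProd y n)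
  else if y 0 = -1 then ENNReal.ofReal (1 / 2 * besselProd (fun i => -y i) n)
  else 0

theorem postPath_zero_of_finiteLast {ω : Traj} (h : ω ∈ finiteLast) :
    postPath ω 0 = 1 ∨ postPath ω 0 = -1 := by
  have h1 := X_g_of_finiteLast h
  have h2 := X_succ_cases (g ω) ω
  simp only [postPath, add_zero]
  omega

theorem IsPenalised.apply_postPath (hQ : IsPenalised φ Q)
    (hφ : HasSum φ 1) (h0 : ∀ k, 0 ≤ φ k) (hmean : Summable fun k : ℕ => (k : ℝ) * φ k)
    {p : ℕ → Traj → Prop} (hp : ∀ l, Det l (p l)) (y : ℕ → ℤ) (n : ℕ) :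
    Q ({ω | p (g ω) ω} ∩ {ω | ∀ i ≤ n, postPath ω i = y i}) =
      Q {ω | p (g ω) ω} * postProb y n := by
  have hfin := hQ.inter_finiteLast hφ h0 hmean
  unfold postProb
  split_ifs with h1 h2
  · have h := hQ.apply_at_g_postPath hφ h0 hmean hp (Or.inl rfl) h1 n
    rw [hfin, hfin] at h
    simpa only [one_mul] using h
  · have h := hQ.apply_at_g_postPath hφ h0 hmean hp (Or.inr rfl) (y := fun i => -y i)
      (by rw [h2]; rfl) n
    rw [hfin, hfin] at h
    simpa only [neg_mul, one_mul, neg_inj] using h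
  · rw [mul_zero, ← hfin]
    convert measure_empty (μ := Q)
    rw [Set.eq_empty_iff_forall_notMem]
    rintro ω ⟨⟨-, h3⟩, h4⟩
    have h5 : postPath ω 0 = y 0 := h3 0 (Nat.zero_le n)
    rcases postPath_zero_of_finiteLast h4 with h | h
    · exact h1 (h5.symm.trans h)
    · exact h2 (h5.symm.trans h)

theorem IsPenalised.indepFun (hQ : IsPenalised φ Q)
    (hφ : HasSum φ 1) (h0 : ∀ k, 0 ≤ φ k) (hmean : Summable fun k : ℕ => (k : ℝ) * φ k) :
    IndepFun (pathUpTo g) postPath Q := by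
  have := hQ.isProbabilityMeasure
  rw [indepFun_iff_measure_inter_preimage_eq_mul]
  intro A B hA hB
  have hp : ∀ l, Det l fun ω => pathUpTo (fun _ => l) ω ∈ A := fun l =>
    (det_pathUpTo l).comp (· ∈ A)
  have hE : pathUpTo g ⁻¹' A = {ω | pathUpTo (fun _ => g ω) ω ∈ A} := rfl
  have hmE : MeasurableSet (pathUpTo g ⁻¹' A) := measurable_pathUpTo measurable_g hA
  have key : (Q.restrict (pathUpTo g ⁻¹' A)).map postPath =
      Q (pathUpTo g ⁻¹' A) • Q.map postPath := by
    have hfin : IsFiniteMeasure ((Q.restrict (pathUpTo g ⁻¹' A)).map postPath) :=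
      Measure.isFiniteMeasure_map _ _
    refine ext_of_generate_finite _ generateFrom_initial_segments isPiSystem_initial_segments
      ?_ ?_
    · rintro _ ⟨n, y, rfl⟩
      have hm : MeasurableSet {f : ℕ → ℤ | ∀ i ≤ n, f i = y i} := by
        rw [generateFrom_initial_segments]
        exact MeasurableSpace.measurableSet_generateFrom ⟨n, y, rfl⟩
      rw [Measure.map_apply measurable_postPath hm, Measure.smul_apply,
        Measure.map_apply measurable_postPath hm,
        Measure.restrict_apply (measurable_postPath hm), Set.inter_comm, smul_eq_mul]
      have h1 := hQ.apply_postPath hφ h0 hmean hp y n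
      have h2 := hQ.apply_postPath hφ h0 hmean det_true y n
      rw [show {_ω : Traj | True} = Set.univ from rfl, Set.univ_inter, measure_univ, one_mul] at h2
      change Q (_ ∩ {ω | ∀ i ≤ n, postPath ω i = y i}) =
        _ * Q {ω | ∀ i ≤ n, postPath ω i = y i}
      rw [hE, h1, h2]
    · rw [Measure.map_apply measurable_postPath MeasurableSet.univ, Measure.smul_apply,
        Measure.map_apply measurable_postPath MeasurableSet.univ]
      simp
  have h := congrArg (fun μ => μ B) key
  simp only [Measure.smul_apply, smul_eq_mul] at h
  rw [Measure.map_apply measurable_postPath hB, Measure.map_apply measurable_postPath hB,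
    Measure.restrict_apply (measurable_postPath hB), Set.inter_comm] at h
  exact h

theorem IsPenalised.apply_X_succ_g (hQ : IsPenalised φ Q)
    (hφ : HasSum φ 1) (h0 : ∀ k, 0 ≤ φ k) (hmean : Summable fun k : ℕ => (k : ℝ) * φ k)
    {p : ℕ → Traj → Prop} (hp : ∀ l, Det l (p l)) {ε : ℤ} (hε : ε = 1 ∨ ε = -1) :
    Q ({ω | p (g ω) ω} ∩ {ω | X (g ω + 1) ω = ε}) = Q {ω | p (g ω) ω} * (1 / 2) := by
  have h := hQ.apply_postPath hφ h0 hmean hp (fun _ => ε) 0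
  have h1 : postProb (fun _ => ε) 0 = 1 / 2 := by
    have : ENNReal.ofReal (1 / 2) = 1 / 2 := by
      rw [ENNReal.ofReal_div_of_pos two_pos]; simp
    rcases hε with rfl | rfl <;> simp [postProb, besselProd]
  rw [h1] at h
  simpa [postPath] using h

theorem IsPenalised.apply_X_succ_g' (hQ : IsPenalised φ Q)
    (hφ : HasSum φ 1) (h0 : ∀ k, 0 ≤ φ k) (hmean : Summable fun k : ℕ => (k : ℝ) * φ k)
    {ε : ℤ} (hε : ε = 1 ∨ ε = -1) : Q {ω | X (g ω + 1) ω = ε} = 1 / 2 := by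
  have := hQ.isProbabilityMeasure
  have h := hQ.apply_X_succ_g hφ h0 hmean det_true hε
  rwa [show {_ω : Traj | True} = Set.univ from rfl, Set.univ_inter, measure_univ, one_mul] at h

theorem measurable_X_succ_g : Measurable fun ω => X (g ω + 1) ω :=
  measurable_X_at ((measurable_of_countable (· + 1)).comp measurable_g)

theorem IsPenalised.isMarkovChainFrom (hQ : IsPenalised φ Q)
    (hφ : HasSum φ 1) (h0 : ∀ k, 0 ≤ φ k) (hmean : Summable fun k : ℕ => (k : ℝ) * φ k)
    {ε : ℤ} (hε : ε = 1 ∨ ε = -1) :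
    IsMarkovChainFrom (Q[|{ω | X (g ω + 1) ω = ε}]) (fun ω i => ε * postPath ω i)
      besselStar 1 := by
  have := hQ.isProbabilityMeasure
  have hm : MeasurableSet {ω | X (g ω + 1) ω = ε} := measurable_X_succ_g (measurableSet_singleton ε)
  have hεε : ε * ε = 1 := by rcases hε with rfl | rfl <;> norm_num
  refine ⟨measurable_pi_lambda _ fun i => (measurable_of_countable (ε * ·)).comp
    ((measurable_pi_apply i).comp measurable_postPath), fun n x => ?_⟩
  rw [cond_apply hm, hQ.apply_X_succ_g' hφ h0 hmean hε]
  split_ifs with hx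
  · have hset : {ω | X (g ω + 1) ω = ε} ∩ {ω | ∀ i ≤ n, ε * postPath ω i = x i} =
        {ω | ∀ i ≤ n, ε * postPath ω i = x i} := by
      refine Set.inter_eq_right.2 fun ω hω => ?_
      have h1 : ε * X (g ω + 1) ω = 1 := (hω 0 (Nat.zero_le n)).trans hx
      change X (g ω + 1) ω = ε
      rcases hε with rfl | rfl <;> omega
    have h := hQ.apply_at_g_postPath hφ h0 hmean det_true hε hx n
    rw [hQ.inter_finiteLast hφ h0 hmean, hQ.inter_finiteLast hφ h0 hmean,
      show {_ω : Traj | True} = Set.univ from rfl, Set.univ_inter, measure_univ, one_mul] at h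
    rw [hset, h, ENNReal.ofReal_mul (by norm_num), ENNReal.ofReal_div_of_pos two_pos, ← mul_assoc]
    simp only [ENNReal.ofReal_one, ENNReal.ofReal_ofNat]
    rw [ENNReal.inv_mul_cancel (by simp) (by simp), one_mul]
    rfl
  · have hset : {ω | X (g ω + 1) ω = ε} ∩ {ω | ∀ i ≤ n, ε * postPath ω i = x i} = ∅ := by
      rw [Set.eq_empty_iff_forall_notMem]
      rintro ω ⟨h1, h2⟩
      have h3 : ε * X (g ω + 1) ω = x 0 := h2 0 (Nat.zero_le n)
      rw [show X (g ω + 1) ω = ε from h1, hεε] at h3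
      exact hx h3.symm
    rw [hset, measure_empty, mul_zero]

/-! ### The path before the last zero -/

/-- The walk has at least `a` zeros. -/
def finiteHit (a : ℕ) : Set Traj := ⋃ l, zeroAt a l

theorem measurableSet_finiteHit (a : ℕ) : MeasurableSet (finiteHit a) :=
  MeasurableSet.iUnion fun l => measurableSet_of_filtration (measurableSet_zeroAt a l)

theorem ae_finiteHit {a : ℕ} (ha : 1 ≤ a) : ∀ᵐ ω ∂P, ω ∈ finiteHit a := by
  change finiteHit a ∈ ae P
  rw [mem_ae_iff_prob_eq_one (measurableSet_finiteHit a)]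
  refine le_antisymm prob_le_one ?_
  have hlim : Tendsto (fun k : ℕ => ENNReal.ofReal (stayProb k ^ (a - 1))) atTop (𝓝 1) := by
    have h1 : Tendsto (fun k : ℕ => 1 / (2 * ((k : ℝ) + 1))) atTop (𝓝 0) := by
      have := (tendsto_one_div_add_atTop_nhds_zero_nat (𝕜 := ℝ)).const_mul (1 / 2)
      rw [mul_zero] at this
      refine this.congr fun k => ?_
      field_simp
    have h2 := ((tendsto_const_nhds (x := (1 : ℝ))).sub h1).pow (a - 1)
    rw [sub_zero, one_pow] at h2
    have h3 := (ENNReal.continuous_ofReal.tendsto _).comp h2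
    rwa [ENNReal.ofReal_one] at h3
  refine le_of_tendsto hlim (Eventually.of_forall fun k => ?_)
  have hs := hasSum_zeroAt_S_le k ha
  rw [← hs.tsum_eq, ENNReal.ofReal_tsum_of_nonneg (fun _ => measureReal_nonneg) hs.summable,
    finiteHit, measure_iUnion (pairwise_disjoint_zeroAt a)
      fun l => measurableSet_of_filtration (measurableSet_zeroAt a l)]
  refine ENNReal.tsum_le_tsum fun l => ?_
  rw [ofReal_measureReal]
  exact measure_mono Set.inter_subset_left

theorem P_at_τ {a : ℕ} (ha : 1 ≤ a) {p : ℕ → Traj → Prop} (hp : ∀ l, Det l (p l)) :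
    P {ω | p (τ a ω) ω} = ∑' l, P (zeroAt a l ∩ {ω | p l ω}) := by
  have h1 : P {ω | p (τ a ω) ω} = P ({ω | p (τ a ω) ω} ∩ finiteHit a) :=
    measure_congr ((ae_finiteHit ha).mono fun _ hω => propext (and_iff_left hω).symm)
  have hset : {ω | p (τ a ω) ω} ∩ finiteHit a = ⋃ l, zeroAt a l ∩ {ω | p l ω} := by
    rw [finiteHit, Set.inter_iUnion]
    refine Set.iUnion_congr fun l => Set.ext fun ω => ?_
    rw [Set.inter_comm]
    refine and_congr_right fun h => ?_
    simp only [Set.mem_ofPred_eq, τ_of_zeroAt h]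
  rw [h1, hset, measure_iUnion]
  · exact fun i j hij => (pairwise_disjoint_zeroAt a hij).mono Set.inter_subset_left
      Set.inter_subset_left
  · exact fun l => measurableSet_of_filtration
      ((measurableSet_zeroAt a l).inter (hp l).measurableSet)

theorem IsPenalised.apply_γ_S_eq_τ (hQ : IsPenalised φ Q)
    (hφ : HasSum φ 1) (h0 : ∀ k, 0 ≤ φ k) (hmean : Summable fun k : ℕ => (k : ℝ) * φ k)
    {a : ℕ} (ha : 1 ≤ a) (k : ℕ) {p : ℕ → Traj → Prop} (hp : ∀ l, Det l (p l)) :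
    Q ({ω | γ (g ω) ω = a ∧ S (g ω) ω = k} ∩ {ω | p (g ω) ω}) =
      ENNReal.ofReal (1 / 2 * φ k) * P ({ω | S (τ a ω) ω = k} ∩ {ω | p (τ a ω) ω}) := by
  have h1 := hQ.apply_γ_S_at_g hφ h0 hmean a k hp
  rw [hQ.inter_finiteLast hφ h0 hmean] at h1
  have h2 := P_at_τ ha (p := fun l ω => S l ω = k ∧ p l ω) fun l =>
    ((det_S le_rfl).comp fun s => s = (k : ℤ)).comp₂ (hp l) And
  change Q {ω | (γ (g ω) ω = a ∧ S (g ω) ω = k) ∧ p (g ω) ω} =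
    _ * P {ω | S (τ a ω) ω = k ∧ p (τ a ω) ω}
  rw [h1, h2]
  congr 1
  refine tsum_congr fun l => ?_
  rw [Set.inter_assoc]
  rfl

theorem IsPenalised.identDistrib (hQ : IsPenalised φ Q)
    (hφ : HasSum φ 1) (h0 : ∀ k, 0 ≤ φ k) (hmean : Summable fun k : ℕ => (k : ℝ) * φ k)
    (a b : ℕ) (hne : Q {ω | γ (g ω) ω = a ∧ S (g ω) ω = b} ≠ 0) :
    IdentDistrib (pathUpTo g) (pathUpTo (τ a))
      (Q[|{ω | γ (g ω) ω = a ∧ S (g ω) ω = b}]) (P[|{ω | S (τ a ω) ω = b}]) := by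
  have ha : 1 ≤ a := by
    rcases Nat.eq_zero_or_pos a with rfl | h
    · refine absurd ?_ hne
      rw [← hQ.inter_finiteLast hφ h0 hmean]
      convert measure_empty (μ := Q)
      rw [Set.eq_empty_iff_forall_notMem]
      rintro ω ⟨h1, h2⟩
      have := γ_pos_of_zero (X_g_of_finiteLast h2)
      have e : γ (g ω) ω = 0 := h1.1
      omega
    · exact h
  refine ⟨(measurable_pathUpTo measurable_g).aemeasurable,
    (measurable_pathUpTo (measurable_τ a)).aemeasurable, Measure.ext fun A hA => ?_⟩
  have hmS : MeasurableSet {ω | S (τ a ω) ω = b} :=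
    measurableSet_at (measurable_τ a) (p := fun l ω => S l ω = b) fun _ =>
      (det_S le_rfl).comp fun s => s = (b : ℤ)
  have h1 := hQ.apply_γ_S_eq_τ hφ h0 hmean ha b (p := fun l ω => pathUpTo (fun _ => l) ω ∈ A)
    fun l => (det_pathUpTo l).comp (· ∈ A)
  have h2 := hQ.apply_γ_S_eq_τ hφ h0 hmean ha b det_true
  rw [show {_ω : Traj | True} = Set.univ from rfl, Set.inter_univ, Set.inter_univ] at h2
  rw [Measure.map_apply (measurable_pathUpTo measurable_g) hA,
    Measure.map_apply (measurable_pathUpTo (measurable_τ a)) hA,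
    cond_apply (measurableSet_γ_S_at_g a b), cond_apply hmS]
  change _ * Q (_ ∩ {ω | pathUpTo (fun _ => g ω) ω ∈ A}) =
    _ * P (_ ∩ {ω | pathUpTo (fun _ => τ a ω) ω ∈ A})
  rw [h2] at hne
  have hc := left_ne_zero_of_mul hne
  rw [h1, h2, ENNReal.mul_inv (Or.inl hc) (Or.inl ENNReal.ofReal_ne_top), mul_mul_mul_comm,
    mul_comm _ (ENNReal.ofReal _), ENNReal.mul_inv_cancel hc ENNReal.ofReal_ne_top, one_mul]

/-! ### The overall maximum -/

theorem S_le_iff (n : ℕ) (ω : Traj) (K : ℤ) : S n ω ≤ K ↔ ∀ i ≤ n, X i ω ≤ K := by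
  simp [S, Finset.sup'_le_iff]

theorem X_neg_after_g {ω : Traj} (h : ω ∈ finiteLast) (h1 : X (g ω + 1) ω = -1) {i : ℕ}
    (hi : g ω < i) : X i ω < 0 := by
  induction i, hi using Nat.le_induction with
  | base => change X (g ω + 1) ω < 0; omega
  | succ i hi ih =>
    have := X_after_g h (show g ω < i + 1 by omega)
    rcases X_succ_cases i ω with h | h <;> omega

theorem X_pos_after_g {ω : Traj} (h : ω ∈ finiteLast) (h1 : X (g ω + 1) ω = 1) {i : ℕ}
    (hi : g ω < i) : 0 < X i ω := by
  induction i, hi using Nat.le_induction with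
  | base => change 0 < X (g ω + 1) ω; omega
  | succ i hi ih =>
    have := X_after_g h (show g ω < i + 1 by omega)
    rcases X_succ_cases i ω with h | h <;> omega

theorem Sinf_of_neg {ω : Traj} (h : ω ∈ finiteLast) (h1 : X (g ω + 1) ω = -1) :
    Sinf ω = (S (g ω) ω).toNat := by
  refine le_antisymm (iSup_le fun n => ?_) (le_iSup (fun n => ((S n ω).toNat : ℕ∞)) (g ω))
  have hS : S n ω ≤ S (g ω) ω := by
    rw [S_le_iff]
    intro i hi
    have hg : 0 ≤ S (g ω) ω := by
      rw [← X_g_of_finiteLast h]; exact X_le_S _ _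
    rcases Nat.lt_or_ge (g ω) i with hi' | hi'
    · exact (X_neg_after_g h h1 hi').le.trans hg
    · exact (X_le_S i ω).trans (S_mono ω hi')
  exact_mod_cast Int.toNat_le_toNat hS

theorem IsPenalised.apply_S_le (hQ : IsPenalised φ Q)
    (hφ : HasSum φ 1) (h0 : ∀ k, 0 ≤ φ k) (n K : ℕ) :
    Q {ω | 0 < X n ω ∧ S n ω ≤ K} ≤
      ENNReal.ofReal ((2 * K + 1) * P.real {ω | S n ω ≤ K}) := by
  have hm : MeasurableSet[ℱ n] {ω : Traj | 0 < X n ω ∧ S n ω ≤ K} :=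
    ((det_X le_rfl).comp₂ (det_S le_rfl) fun x s => 0 < x ∧ s ≤ (K : ℤ)).measurableSet
  rw [hQ.apply_eq n _ hm]
  refine ENNReal.ofReal_le_ofReal ?_
  have hmono : P.real {ω : Traj | 0 < X n ω ∧ S n ω ≤ K} ≤ P.real {ω | S n ω ≤ K} :=
    measureReal_mono fun ω hω => hω.2
  have hbound := norm_setIntegral_le_of_norm_le_const_ae (μ := P) (f := M φ n)
    (s := {ω : Traj | 0 < X n ω ∧ S n ω ≤ K}) (C := 2 * K + 1) (measure_lt_top _ _) (by
      rw [ae_restrict_iff' (measurableSet_of_filtration hm)]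
      refine ae_X_zero.mono fun ω hω h => ?_
      have hX0 : (0 : ℝ) < X n ω := by exact_mod_cast h.1
      have hXS : (X n ω : ℝ) ≤ S n ω := by exact_mod_cast X_le_S n ω
      have hSK : (S n ω : ℝ) ≤ K := by exact_mod_cast h.2
      rw [Real.norm_of_nonneg (M_nonneg h0 hω n), M, atMax, atMax, atMax, max_eq_left hX0.le,
        abs_of_pos hX0]
      have e1 := le_one_of_hasSum h0 hφ (S (lastZeroBefore n ω) ω).toNat
      have e2 := le_one_of_hasSum h0 hφ (S n ω).toNat
      have e3 := tail_le_one h0 hφ (S n ω).toNat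
      have e4 := h0 (S (lastZeroBefore n ω) ω).toNat
      have e5 := h0 (S n ω).toNat
      nlinarith)
  refine (le_abs_self _).trans (hbound.trans ?_)
  exact mul_le_mul_of_nonneg_left hmono (by positivity)

theorem IsPenalised.ae_Sinf_of_pos (hQ : IsPenalised φ Q)
    (hφ : HasSum φ 1) (h0 : ∀ k, 0 ≤ φ k) (hmean : Summable fun k : ℕ => (k : ℝ) * φ k) :
    ∀ᵐ ω ∂Q, X (g ω + 1) ω = 1 → Sinf ω = ⊤ := by
  have hnull : ∀ N K : ℕ, Q {ω | ∀ n ≥ N, 0 < X n ω ∧ S n ω ≤ K} = 0 := by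
    intro N K
    have hlim : Tendsto (fun n => ENNReal.ofReal ((2 * K + 1) * P.real {ω | S n ω ≤ K})) atTop
        (𝓝 0) := by
      have h := (tendsto_P_real_S_le K).const_mul (2 * (K : ℝ) + 1)
      rw [mul_zero] at h
      have h' := (ENNReal.continuous_ofReal.tendsto _).comp h
      rwa [ENNReal.ofReal_zero] at h'
    refine le_antisymm (ge_of_tendsto hlim ?_) bot_le
    filter_upwards [eventually_ge_atTop N] with n hn
    have hsub : {ω | ∀ n ≥ N, 0 < X n ω ∧ S n ω ≤ K} ⊆ {ω | 0 < X n ω ∧ S n ω ≤ K} :=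
      fun ω hω => hω n hn
    exact (measure_mono hsub).trans (hQ.apply_S_le hφ h0 n K)
  have hae : ∀ᵐ ω ∂Q, ∀ N K : ℕ, ¬ ∀ n ≥ N, 0 < X n ω ∧ S n ω ≤ K :=
    ae_all_iff.2 fun N => ae_all_iff.2 fun K => measure_eq_zero_iff_ae_notMem.1 (hnull N K)
  filter_upwards [hae, hQ.ae_finiteLast hφ h0 hmean] with ω h1 h2 h3
  by_contra htop
  obtain ⟨K, hK⟩ := ENat.ne_top_iff_exists.1 htop
  refine h1 (g ω + 1) K fun n hn => ⟨X_pos_after_g h2 h3 hn, ?_⟩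
  have h4 : ((S n ω).toNat : ℕ∞) ≤ Sinf ω := le_iSup (fun n => ((S n ω).toNat : ℕ∞)) n
  rw [← hK] at h4
  have h5 : (S n ω).toNat ≤ K := by exact_mod_cast h4
  omega

theorem IsPenalised.Sinf_eq_top (hQ : IsPenalised φ Q)
    (hφ : HasSum φ 1) (h0 : ∀ k, 0 ≤ φ k) (hmean : Summable fun k : ℕ => (k : ℝ) * φ k) :
    Q {ω | Sinf ω = ⊤} = 1 / 2 := by
  rw [← hQ.apply_X_succ_g' hφ h0 hmean (Or.inl rfl)]
  refine measure_congr ?_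
  filter_upwards [hQ.ae_Sinf_of_pos hφ h0 hmean, hQ.ae_finiteLast hφ h0 hmean] with ω h1 h2
  refine propext ⟨fun h => ?_, h1⟩
  rcases postPath_zero_of_finiteLast h2 with h3 | h3
  · exact h3
  · have h4 : Sinf ω = ⊤ := h
    rw [Sinf_of_neg h2 h3] at h4
    exact absurd h4 (ENat.natCast_ne_top _)

theorem IsPenalised.apply_S_g (hQ : IsPenalised φ Q)
    (hφ : HasSum φ 1) (h0 : ∀ k, 0 ≤ φ k) (hmean : Summable fun k : ℕ => (k : ℝ) * φ k) (k : ℕ) :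
    Q {ω | S (g ω) ω = k} = ENNReal.ofReal (φ k) := by
  rw [← hQ.inter_finiteLast hφ h0 hmean, hQ.apply_S hφ h0 hmean]

theorem IsPenalised.apply_Sinf (hQ : IsPenalised φ Q)
    (hφ : HasSum φ 1) (h0 : ∀ k, 0 ≤ φ k) (hmean : Summable fun k : ℕ => (k : ℝ) * φ k) (k : ℕ) :
    Q {ω | Sinf ω = k} = ENNReal.ofReal (φ k) * (1 / 2) := by
  have h := hQ.apply_X_succ_g hφ h0 hmean (p := fun l ω => S l ω = k)
    (fun _ => (det_S le_rfl).comp fun s => s = (k : ℤ)) (Or.inr rfl)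
  rw [hQ.apply_S_g hφ h0 hmean] at h
  rw [← h]
  refine measure_congr ?_
  filter_upwards [hQ.ae_Sinf_of_pos hφ h0 hmean, hQ.ae_finiteLast hφ h0 hmean] with ω h1 h2
  refine propext ?_
  change Sinf ω = k ↔ S (g ω) ω = k ∧ X (g ω + 1) ω = -1
  have hg : 0 ≤ S (g ω) ω := by rw [← X_g_of_finiteLast h2]; exact X_le_S _ _
  rcases postPath_zero_of_finiteLast h2 with h3 | h3
  · have h4 : X (g ω + 1) ω = 1 := h3
    rw [h1 h4, h4]
    simp
  · have h4 : X (g ω + 1) ω = -1 := h3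
    rw [Sinf_of_neg h2 h4, h4, Nat.cast_inj]
    constructor
    · exact fun h => ⟨by omega, rfl⟩
    · exact fun h => by omega

theorem measurable_Sinf : Measurable Sinf := by
  refine measurable_enat_of_le fun l => ?_
  have : {ω | Sinf ω ≤ l} = ⋂ k : ℕ, {ω | S k ω ≤ l} := by
    ext ω
    simp [Sinf, iSup_le_iff]
  rw [this]
  exact MeasurableSet.iInter fun k => measurableSet_of_filtration (measurableSet_S_le k l)

theorem IsPenalised.cond_Sinf (hQ : IsPenalised φ Q)
    (hφ : HasSum φ 1) (h0 : ∀ k, 0 ≤ φ k) (hmean : Summable fun k : ℕ => (k : ℝ) * φ k) (k : ℕ) :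
    Q[|{ω | Sinf ω < ⊤}] {ω | Sinf ω = k} = ENNReal.ofReal (φ k) := by
  have := hQ.isProbabilityMeasure
  have h2 : {ω | Sinf ω < ⊤} = {ω | Sinf ω = ⊤}ᶜ := by
    ext ω; simp [lt_top_iff_ne_top]
  have h3 : MeasurableSet {ω | Sinf ω = ⊤} := measurable_Sinf (measurableSet_singleton ⊤)
  have hm : MeasurableSet {ω | Sinf ω < ⊤} := h2 ▸ h3.compl
  have h1 : Q {ω | Sinf ω < ⊤} = 1 / 2 := by
    rw [h2, prob_compl_eq_one_sub h3, hQ.Sinf_eq_top hφ h0 hmean]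
    simp
  have h4 : {ω | Sinf ω < ⊤} ∩ {ω | Sinf ω = k} = {ω | Sinf ω = k} := by
    refine Set.inter_eq_right.2 fun ω hω => ?_
    have : Sinf ω = k := hω
    change Sinf ω < ⊤
    rw [this]; exact ENat.natCast_lt_top k
  rw [cond_apply hm, h1, h4, hQ.apply_Sinf hφ h0 hmean, mul_comm, mul_assoc,
    ENNReal.mul_inv_cancel (by simp) (by simp), mul_one]

/-! ### Failure of uniform integrability -/

theorem not_uniformIntegrable_M (hφ : HasSum φ 1) (h0 : ∀ k, 0 ≤ φ k)
    (hmean : Summable fun k : ℕ => (k : ℝ) * φ k) : ¬ UniformIntegrable (M φ) 1 P := by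
  rintro ⟨-, hUI, -⟩
  obtain ⟨Q, hQ⟩ := exists_isPenalised hφ h0
  obtain ⟨k, hk⟩ : ∃ k, 0 < φ k := by
    by_contra! h
    have : φ = fun _ => 0 := funext fun k => le_antisymm (h k) (h0 k)
    rw [this] at hφ
    exact zero_ne_one (hasSum_zero.unique hφ)
  obtain ⟨δ, hδ, h⟩ := hUI (ε := φ k / 4) (by positivity)
  obtain ⟨n, hn⟩ := ((tendsto_P_real_S_le k).eventually (gt_mem_nhds hδ)).exists
  have hmn := measurableSet_S_le n k
  have hm := measurableSet_of_filtration hmn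
  have h1 := h n _ hm (by
    rw [← ofReal_measureReal]; exact ENNReal.ofReal_le_ofReal hn.le)
  rw [eLpNorm_one_eq_lintegral_enorm] at h1
  have h2 : ENNReal.ofReal (φ k) * (1 / 2) ≤ ENNReal.ofReal (∫ ω in {ω | S n ω ≤ k}, M φ n ω ∂P) := by
    rw [← hQ.apply_eq n _ hmn, ← hQ.apply_Sinf hφ h0 hmean]
    refine measure_mono fun ω hω => ?_
    have h4 : ((S n ω).toNat : ℕ∞) ≤ Sinf ω := le_iSup (fun n => ((S n ω).toNat : ℕ∞)) n
    rw [show Sinf ω = k from hω] at h4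
    have h5 : (S n ω).toNat ≤ k := by exact_mod_cast h4
    change S n ω ≤ k
    omega
  have h3 : ENNReal.ofReal (∫ ω in {ω | S n ω ≤ k}, M φ n ω ∂P) ≤ ENNReal.ofReal (φ k / 4) := by
    refine le_trans ?_ h1
    have e : (fun ω => ‖({ω | S n ω ≤ k} : Set Traj).indicator (M φ n) ω‖ₑ) =
        ({ω | S n ω ≤ k} : Set Traj).indicator fun ω => ‖M φ n ω‖ₑ := by
      funext ω; exact enorm_indicator_eq_indicator_enorm _ _
    rw [e, lintegral_indicator hm]
    refine le_trans (ENNReal.ofReal_le_ofReal (le_abs_self _)) ?_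
    rw [← Real.norm_eq_abs, ofReal_norm]
    exact enorm_integral_le_lintegral_enorm _
  have h4 := h2.trans h3
  have e : (1 / 2 : ℝ≥0∞) = ENNReal.ofReal (1 / 2) := by
    rw [ENNReal.ofReal_div_of_pos two_pos]; simp
  rw [e, ← ENNReal.ofReal_mul (h0 k), ENNReal.ofReal_le_ofReal_iff (by positivity)] at h4
  linarith

end

end Penalisation

theorem mainTheorem1 (φ : ℕ → ℝ) (hφ_nonneg : ∀ k, 0 ≤ φ k) (hφ_sum : HasSum φ 1)
    (hφ_mean : Summable fun k : ℕ => (k : ℝ) * φ k) :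
    -- 1(a): the penalisation limit
    (∀ (n : ℕ) (Λ : Set Traj), MeasurableSet[ℱ n] Λ →
      Tendsto
        (fun p : ℕ =>
          (∫ ω in Λ, atMax φ (lastZeroBefore p ω) ω ∂P) /
            (∫ ω, atMax φ (lastZeroBefore p ω) ω ∂P))
        atTop (𝓝 (∫ ω in Λ, M φ n ω ∂P))) ∧
    -- 1(b): `M` is a nonnegative martingale which is not uniformly integrable
    (Martingale (M φ) ℱ P ∧ (∀ᵐ ω ∂P, ∀ n, 0 ≤ M φ n ω) ∧ ¬ UniformIntegrable (M φ) 1 P) ∧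
    -- 2: the probability `Q` exists and is unique
    (∃! Q : Measure Traj, IsPenalised φ Q) ∧
    ∀ Q : Measure Traj, IsPenalised φ Q →
      -- 2(a): the last zero is finite
      Q {ω | lastZero ω < ⊤} = 1 ∧
      -- 2(b): the law of the overall maximum
      (Q {ω | Sinf ω = ⊤} = 1 / 2 ∧
        ∀ k : ℕ, Q[|{ω | Sinf ω < ⊤}] {ω | Sinf ω = k} = ENNReal.ofReal (φ k)) ∧
      -- 2(c): the joint law of the number of zeros and of the maximum up to the last zero
      ((∀ a k : ℕ, 1 ≤ a →
          Q {ω | γ (g ω) ω = a ∧ S (g ω) ω = k} = ENNReal.ofReal (jointDensity φ a k)) ∧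
        ∀ k : ℕ, Q {ω | S (g ω) ω = k} = ENNReal.ofReal (φ k)) ∧
      -- 3(a): the paths before and after the last zero are independent
      IndepFun (pathUpTo g) postPath Q ∧
      -- 3(b): with probability 1/2 each, plus or minus the path after `g` is a 3-Bessel* walk
      (Q {ω | X (g ω + 1) ω = 1} = 1 / 2 ∧
        IsMarkovChainFrom (Q[|{ω | X (g ω + 1) ω = 1}]) postPath besselStar 1 ∧
        Q {ω | X (g ω + 1) ω = -1} = 1 / 2 ∧
        IsMarkovChainFrom (Q[|{ω | X (g ω + 1) ω = -1}]) (fun ω => -postPath ω) besselStar 1) ∧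
      -- 3(c): the conditional law of the path up to the last zero
      (∀ a b : ℕ, Q {ω | γ (g ω) ω = a ∧ S (g ω) ω = b} ≠ 0 →
        IdentDistrib (pathUpTo g) (pathUpTo (τ a))
          (Q[|{ω | γ (g ω) ω = a ∧ S (g ω) ω = b}]) (P[|{ω | S (τ a ω) ω = b}])) := by
  refine ⟨fun n Λ hΛ => penalisation_limit hφ_sum hφ_nonneg hΛ,
    ⟨martingale_M hφ_sum.summable hφ_nonneg, ae_M_nonneg hφ_nonneg,
      not_uniformIntegrable_M hφ_sum hφ_nonneg hφ_mean⟩,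
    existsUnique_isPenalised hφ_sum hφ_nonneg, fun Q hQ => ?_⟩
  have := hQ.isProbabilityMeasure
  refine ⟨?_, ⟨hQ.Sinf_eq_top hφ_sum hφ_nonneg hφ_mean, hQ.cond_Sinf hφ_sum hφ_nonneg hφ_mean⟩,
    ⟨fun a k ha => ?_, hQ.apply_S_g hφ_sum hφ_nonneg hφ_mean⟩,
    hQ.indepFun hφ_sum hφ_nonneg hφ_mean,
    ⟨hQ.apply_X_succ_g' hφ_sum hφ_nonneg hφ_mean (Or.inl rfl), ?_,
      hQ.apply_X_succ_g' hφ_sum hφ_nonneg hφ_mean (Or.inr rfl), ?_⟩,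
    hQ.identDistrib hφ_sum hφ_nonneg hφ_mean⟩
  · refine (measure_congr (eventuallyEq_univ.2 ?_)).trans measure_univ
    filter_upwards [hQ.ae_finiteLast hφ_sum hφ_nonneg hφ_mean] with ω hω
    obtain ⟨l, hl⟩ := Set.mem_iUnion.1 hω
    rw [lastZero_of_lastAt hl]
    exact ENat.natCast_lt_top l
  · rw [← hQ.inter_finiteLast hφ_sum hφ_nonneg hφ_mean]
    exact hQ.apply_γ_S hφ_sum hφ_nonneg hφ_mean ha k
  · have h := hQ.isMarkovChainFrom hφ_sum hφ_nonneg hφ_mean (Or.inl rfl)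
    simp only [one_mul] at h
    exact h
  · have h := hQ.isMarkovChainFrom hφ_sum hφ_nonneg hφ_mean (Or.inr rfl)
    simp only [neg_mul, one_mul] at h
    exact h
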